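/- **Setting.** Let $K\ge 2$ be an even integer, $N_{\mathrm n},N_{\mathrm f}\ge 1$ integers, and $\Omega_{\mathrm n},\Omega_{\mathrm f},\Omega_{\mathrm p},I,B,T,\theta,\mathscr N_0>0$ and $\delta\in(0,1)$ real numbers. A transmitter serves a pair of users, $\mathrm U_{\mathrm n}$ (near) and $\mathrm U_{\mathrm f}$ (far), having $N_{\mathrm n}$ and $N_{\mathrm f}$ antennas, over independent Rayleigh channels $h_{u,i}=\sqrt{\Omega_u}\,\hat h_{u,i}$, $u\in\{\mathrm n,\mathrm f\}$, $1\le i\le N_u$, with $\hat h_{u,i}\sim\mathcal{CN}(0,1)$ independent. Let $g_u=\sum_{i=1}^{N_u}|h_{u,i}|^2$. The power allocation coefficients satisfy $0<a_{\mathrm s}<a_{\mathrm w}$ and $a_{\mathrm s}+a_{\mathrm w}=2/K$. Put $\mathcal B=2B/K$, $P_{\mathrm t}^*=-I/(\Omega_{\mathrm p}\ln\delta)$, $\hat P_{\mathrm t}^*=P_{\mathrm t}^*/(\mathscr N_0\mathcal B)$, $\Omega=\Omega_{\mathrm n}\Omega_{\mathrm f}/(\Omega_{\mathrm n}+\Omega_{\mathrm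 f})$ and $\nu=\theta T\mathcal B/\ln 2$; assume that $\nu$ is not an integer. The effective rate belonging to a random SINR $\gamma$ is $-\frac1\nu\log_2\mathbb E[(1+\gamma)^{-\nu}]$. The transmit power is the constant $P_{\mathrm t}^*$, so that a receiver with channel gain $g$ sees the weak user's symbol with SINR $\gamma(g)=a_{\mathrm w}\hat P_{\mathrm t}^*g/(1+a_{\mathrm s}\hat P_{\mathrm t}^*g)$. * Case S–I: the weak user is the one with the smaller gain, and $\gamma_{\mathrm w}=\gamma(g_{\mathrm w})$ with $g_{\mathrm w}=\min\{g_{\mathrm n},g_{\mathrm f}\}$. * Case S–S: the weak user is fixed to be $\mathrm U_{\mathrm f}$, and, since its symbol has to be decoded at both users, $\gamma_{\mathrm w}=\min\{\gamma(g_{\mathrm n}),\gamma(g_{\mathrm f})\}$. **Special function.** For real $\alpha\geq 1$ and $x,y>0$, the extended generalized bivariate Meijer G-function below is the absolutely convergent iterated Mellin–Barnes integral $$\mathcal G_{1,1:1,1:0,1}^{1,1:1,1:1,0}\left(\begin{smallmatrix}1-\alpha\\ \nu-\alpha\end{smallmatrix}\middle|\begin{smallmatrix}1+\nu\\0\end{smallmatrix}\middle|\begin{smallmatrix}-\\0\end{smallmatrix}\middle|x,y\right)=\frac1{2\pi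 i}\int_{L}\Gamma(s)\Gamma(-\nu-s)x^{-s}\left[\frac1{2\pi i}\int_{L_s}\Gamma(\nu-\alpha+s+t)\Gamma(\alpha-s-t)\Gamma(t)\,y^{-t}\,dt\right]ds .$$ The contours run from $-i\infty$ to $+i\infty$. For each $s\in L$, the contour $L_s$ has the poles (in $t$) of $\Gamma(t)$ and $\Gamma(\nu-\alpha+s+t)$ on its left and those of $\Gamma(\alpha-s-t)$ on its right. The contour $L$ has the poles of $\Gamma(s)$ on its left, and the poles of $\Gamma(-\nu-s)$ and the points $\alpha,\alpha+1,\dots$ (the poles of the inner integral) on its right. **Claim.** For the values $\alpha=\alpha_1+\tau$ and the arguments occurring below, the integrals defining $\mathcal G$ converge absolutely. With $$T_6(\alpha_1,\alpha_2,\beta_1,\beta_2)=\sum_{\tau=0}^{\alpha_2-1}\frac{(2\hat P_{\mathrm t}^*/K)^{-(\alpha_1+\tau)}}{\Gamma(\alpha_1)\Gamma(\nu)\Gamma(-\nu)\beta_1^{\alpha_1}\beta_2^{\tau}\,\tau!}\;\mathcal G_{1,1:1,1:0,1}^{1,1:1,1:1,0}\left(\begin{smallmatrix}1-(\alpha_1+\tau)\\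 \nu-(\alpha_1+\tau)\end{smallmatrix}\middle|\begin{smallmatrix}1+\nu\\0\end{smallmatrix}\middle|\begin{smallmatrix}-\\0\end{smallmatrix}\middle|\tfrac K2a_{\mathrm s},\tfrac{K}{2\Omega\hat P_{\mathrm t}^*}\right),$$ the number $T_6(N_{\mathrm n},N_{\mathrm f},\Omega_{\mathrm n},\Omega_{\mathrm f})+T_6(N_{\mathrm f},N_{\mathrm n},\Omega_{\mathrm f},\Omega_{\mathrm n})$ is real and positive, and both in Case S–I and in Case S–S the effective rate of the weak user is $$R_{\mathrm w}=-\frac1\nu\log_2\left[T_6(N_{\mathrm n},N_{\mathrm f},\Omega_{\mathrm n},\Omega_{\mathrm f})+T_6(N_{\mathrm f},N_{\mathrm n},\Omega_{\mathrm f},\Omega_{\mathrm n})\right].$$ -/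

import Mathlib

open MeasureTheory ProbabilityTheory

noncomputable section

/-! ### The extended generalized bivariate Meijer G-function

The function is the Mellin-Barnes integral
`(2πi)⁻² ∫∫ Γ₁(s + t) Γ₂(s) Γ₃(t) x⁻ˢ y⁻ᵗ dt ds`,
where each `Γⱼ` is a quotient of products of Gamma functions with the parameters of one block, and
each contour runs from `-i∞` to `+i∞`, having on its left the poles of the Gamma factors in which
the variable has coefficient `+1` and on its right those of the Gamma factors in which it has
coefficient `-1`.  The inner contour (variable `t`) may depend on the outer variable `s`. -/

/-- The parameters of one block `G^{m,n}_{p,q}`: `aNum = (a₁,…,aₙ)`, `aDen = (aₙ₊₁,…,a_p)`,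
`bNum = (b₁,…,b_m)`, `bDen = (b_{m+1},…,b_q)`. -/
structure GammaBlock where
  aNum : List ℂ
  aDen : List ℂ
  bNum : List ℂ
  bDen : List ℂ

/-- The kernel
`∏_{j≤m} Γ(bⱼ + u) ∏_{j≤n} Γ(1 - aⱼ - u) / (∏_{j>n} Γ(aⱼ + u) ∏_{j>m} Γ(1 - bⱼ - u))`. -/
def GammaBlock.kernel (G : GammaBlock) (u : ℂ) : ℂ :=
  ((G.bNum.map fun b => Complex.Gamma (b + u)).prod *
      (G.aNum.map fun a => Complex.Gamma (1 - a - u)).prod) /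
    ((G.aDen.map fun a => Complex.Gamma (a + u)).prod *
      (G.bDen.map fun b => Complex.Gamma (1 - b - u)).prod)

/-- The union of the sequences `h, h - 1, h - 2, …` with `h` in the list. -/
def leftPoles (hs : List ℂ) : Set ℂ := {p | ∃ h ∈ hs, ∃ k : ℕ, p = h - k}

/-- The union of the sequences `h, h + 1, h + 2, …` with `h` in the list. -/
def rightPoles (hs : List ℂ) : Set ℂ := {p | ∃ h ∈ hs, ∃ k : ℕ, p = h + k}

/-- An abscissa to the right of all points of `A` (a set bounded to the right), such that no point
of `B` lies on the vertical line through it, nor strictly between that line and the rightmost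
abscissa of `A`.  If a vertical line separates `A` from `B`, the line through this abscissa does. -/
def sepAbscissa (A B : Set ℂ) : ℝ :=
  (sSup (Complex.re '' A) +
    sInf (insert (sSup (Complex.re '' A) + 2)
      {x | sSup (Complex.re '' A) < x ∧ ∃ q ∈ B, q.re = x})) / 2

/-- The points of `B` lying to the left of the vertical line through `sepAbscissa A B`. -/
def misplaced (A B : Set ℂ) : Set ℂ := {p | p ∈ B ∧ p.re < sepAbscissa A B}

/-- Half the minimal distance between two points of `A ∪ B` (and at most `1/2`). -/
def sepRadius (A B : Set ℂ) : ℝ :=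
  sInf (insert 1 {ρ | ∃ p ∈ A ∪ B, ∃ q ∈ A ∪ B, p ≠ q ∧ ρ = dist p q}) / 2

/-- `(2πi)⁻¹ ∫_L f(s) ds`, where the contour `L` runs from `-i∞` to `+i∞` with the poles in `A` on
its left and the poles in `B` on its right.  Concretely `L` is the upward vertical line through
`sepAbscissa A B`, which has all of `A` on its left, together with small clockwise circles around
the finitely many points of `B` that also lie on the left of the line; the circles put these points
on the right of `L`.  An indented curve separating `A` from `B` is homologous to this cycle. -/
def mellinBarnes (A B : Set ℂ) (f : ℂ → ℂ) : ℂ :=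
  (2 * Real.pi * Complex.I)⁻¹ *
    ((∫ y : ℝ, f (sepAbscissa A B + y * Complex.I)) * Complex.I
      - ∑ᶠ (p : ℂ) (_ : p ∈ misplaced A B), circleIntegral f p (sepRadius A B))

/-- The support of the contour used in `mellinBarnes`. -/
def mellinBarnesContour (A B : Set ℂ) : Set ℂ :=
  {s | s.re = sepAbscissa A B} ∪ ⋃ p ∈ misplaced A B, Metric.sphere p (sepRadius A B)

/-- The two families of poles are disjoint and the integral in `mellinBarnes` converges
absolutely. -/
def MellinBarnesConverges (A B : Set ℂ) (f : ℂ → ℂ) : Prop :=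
  Disjoint A B ∧
    Integrable (fun y : ℝ => f (sepAbscissa A B + y * Complex.I)) ∧
    ∀ p ∈ misplaced A B, CircleIntegrable f p (sepRadius A B)

/-- Poles in `t` of the factors `Γ(b + s + t)` and `Γ(f + t)`. -/
def egbInnerLeft (G₁ G₃ : GammaBlock) (s : ℂ) : Set ℂ :=
  leftPoles (G₁.bNum.map (fun b => -b - s) ++ G₃.bNum.map fun f => -f)

/-- Poles in `t` of the factors `Γ(1 - a - s - t)` and `Γ(1 - e - t)`. -/
def egbInnerRight (G₁ G₃ : GammaBlock) (s : ℂ) : Set ℂ :=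
  rightPoles (G₁.aNum.map (fun a => 1 - a - s) ++ G₃.aNum.map fun e => 1 - e)

/-- Poles in `s` of the factors `Γ(d + s)`, and of the inner integral, which is singular where a
pole of `Γ(b + s + t)` meets a pole of `Γ(1 - e - t)`. -/
def egbOuterLeft (G₁ G₂ G₃ : GammaBlock) : Set ℂ :=
  leftPoles (G₂.bNum.map (fun d => -d) ++
    G₁.bNum.flatMap fun b => G₃.aNum.map fun e => e - 1 - b)

/-- Poles in `s` of the factors `Γ(1 - c - s)`, and of the inner integral, which is singular where
a pole of `Γ(1 - a - s - t)` meets a pole of `Γ(f + t)`. -/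
def egbOuterRight (G₁ G₂ G₃ : GammaBlock) : Set ℂ :=
  rightPoles (G₂.aNum.map (fun c => 1 - c) ++
    G₁.aNum.flatMap fun a => G₃.bNum.map fun f => 1 - a + f)

def egbInnerIntegrand (G₁ G₃ : GammaBlock) (y : ℝ) (s t : ℂ) : ℂ :=
  G₁.kernel (s + t) * G₃.kernel t * (y : ℂ) ^ (-t)

def egbOuterIntegrand (G₁ G₂ G₃ : GammaBlock) (x y : ℝ) (s : ℂ) : ℂ :=
  G₂.kernel s * (x : ℂ) ^ (-s) *
    mellinBarnes (egbInnerLeft G₁ G₃ s) (egbInnerRight G₁ G₃ s) (egbInnerIntegrand G₁ G₃ y s)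

/-- The extended generalized bivariate Meijer G-function `𝒢(G₁ | G₂ | G₃ | x, y)`, where the block
`G₁` has argument `s + t`, the block `G₂` argument `s` and the block `G₃` argument `t`. -/
def egbMeijerG (G₁ G₂ G₃ : GammaBlock) (x y : ℝ) : ℂ :=
  mellinBarnes (egbOuterLeft G₁ G₂ G₃) (egbOuterRight G₁ G₂ G₃) (egbOuterIntegrand G₁ G₂ G₃ x y)

/-- The integrals defining `egbMeijerG G₁ G₂ G₃ x y` converge absolutely. -/
def EGBMeijerGConverges (G₁ G₂ G₃ : GammaBlock) (x y : ℝ) : Prop :=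
  MellinBarnesConverges (egbOuterLeft G₁ G₂ G₃) (egbOuterRight G₁ G₂ G₃)
      (egbOuterIntegrand G₁ G₂ G₃ x y) ∧
    ∀ s ∈ mellinBarnesContour (egbOuterLeft G₁ G₂ G₃) (egbOuterRight G₁ G₂ G₃),
      MellinBarnesConverges (egbInnerLeft G₁ G₃ s) (egbInnerRight G₁ G₃ s)
        (egbInnerIntegrand G₁ G₃ y s)

/-! ### The closed form -/

/-- First block `G^{1,1}_{1,1}` with upper parameter `1 - α` and lower parameter `ν - α`. -/
def t6Block₁ (ν : ℝ) (α : ℕ) : GammaBlock := ⟨[1 - α], [], [ν - α], []⟩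

/-- Second block `G^{1,1}_{1,1}` with upper parameter `1 + ν` and lower parameter `0`. -/
def t6Block₂ (ν : ℝ) : GammaBlock := ⟨[1 + ν], [], [0], []⟩

/-- Third block `G^{1,0}_{0,1}` with no upper parameter and lower parameter `0`. -/
def t6Block₃ : GammaBlock := ⟨[], [], [0], []⟩

/-- `T₆(α₁, α₂, β₁, β₂)`; `P` is the normalized transmit power and `Ωh` the combination
`Ω = Ωₙ Ω_f / (Ωₙ + Ω_f)`. -/
def T6 (ν P aₛ Ωh : ℝ) (K α₁ α₂ : ℕ) (β₁ β₂ : ℝ) : ℂ :=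
  ∑ τ ∈ Finset.range α₂,
    (((2 * P / K) ^ (-((α₁ + τ : ℕ) : ℝ)) /
      (Real.Gamma α₁ * Real.Gamma ν * Real.Gamma (-ν) * β₁ ^ α₁ * β₂ ^ τ * τ.factorial) : ℝ) : ℂ) *
    egbMeijerG (t6Block₁ ν (α₁ + τ)) (t6Block₂ ν) t6Block₃ (K / 2 * aₛ) (K / (2 * Ωh * P))

/-! ### The communication system -/

/-- The law `𝒞𝒩(0, 1)`: independent real and imaginary parts, each of law `N(0, 1/2)`. -/
def stdComplexNormal : Measure ℂ :=
  ((gaussianReal 0 (1 / 2)).prod (gaussianReal 0 (1 / 2))).map fun p : ℝ × ℝ => ⟨p.1, p.2⟩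

/-- Channel gain `∑ᵢ |hᵢ|²` after maximal-ratio combining, with `hᵢ = √Ω ĥᵢ`. -/
def mrcGain {S : Type*} {N : ℕ} (Ωu : ℝ) (hhat : Fin N → S → ℂ) (ω : S) : ℝ :=
  ∑ i, ‖(√Ωu : ℂ) * hhat i ω‖ ^ 2

/-- SINR for decoding the weak user's symbol at a receiver with channel gain `g`, the strong user's
symbol being treated as noise. -/
def sinrWeakSymbol (aₛ a_w P g : ℝ) : ℝ := a_w * P * g / (1 + aₛ * P * g)

/-- Effective rate `-(1/ν) log₂ E[(1 + γ)^{-ν}]`. -/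
def effectiveRate {S : Type*} [MeasurableSpace S] (μ : Measure S) (ν : ℝ) (γ : S → ℝ) : ℝ :=
  -(1 / ν) * Real.logb 2 (∫ ω, (1 + γ ω) ^ (-ν) ∂μ)

/-- Instantaneous secondary-link CSI: the weak user is the one with the smaller gain, and its SINR
is the one at that user. -/
def sinrWeakInstantaneous {S : Type*} (aₛ a_w P : ℝ) (gn gf : S → ℝ) (ω : S) : ℝ :=
  sinrWeakSymbol aₛ a_w P (min (gn ω) (gf ω))

/-- Statistical secondary-link CSI: the weak user is fixed to be the far user, and its symbol has
to be decoded both at the near (strong) user and at the far (weak) user, so that the smaller of the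
two SINRs counts. -/
def sinrWeakStatistical {S : Type*} (aₛ a_w P : ℝ) (gn gf : S → ℝ) (ω : S) : ℝ :=
  min (sinrWeakSymbol aₛ a_w P (gn ω)) (sinrWeakSymbol aₛ a_w P (gf ω))

end

/-! ### The Gamma function on vertical lines -/

/-! The SINR is increasing in the gain, so the minimum of two SINRs is the SINR of the smaller gain
and both cases reduce to one expectation. With `b = 2P/K` and `x = (K/2) aₛ`, the power constraint
gives `1 + γ(g) = (1 + b g) / (1 + x b g)`. Each gain is a sum of independent exponential variables,
hence has a Gamma law of integer shape, whose tail is an exponential times a polynomial. Splitting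
the expectation according to which gain is smaller therefore leaves finitely many integrals of `g ^
(α - 1) exp (-g/Ω)` against `(1 + b g) ^ (-ν) (1 + x b g) ^ ν`, because the rates `1/Ωₙ` and `1/Ω_f`
add up to `1/Ω`. The substitution `u = b g` makes the exponential rate `y = K / (2 Ω P)`.

It remains to show that the Meijer function equals `Γ(ν) Γ(-ν)` times `∫ u ^ (α - 1) exp (-y u) (1 +
u) ^ (-ν) (1 + x u) ^ ν du` (`egbMeijerG_t6`). In the inner integral the beta integral turns two of
the Gamma factors into a Mellin transform of `(1 + u) ^ (-ν)`, while `Γ(t) (y u) ^ (-t)` integrates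
to `exp (-y u)` (`integral_inner_vertical`).

In the outer integral `Γ(s) Γ(-ν - s) (x u) ^ (-s)` should yield `Γ(-ν) (1 + x u) ^ ν`, but no
vertical line separates the poles of `Γ(s)` from those of `Γ(-ν - s)` when `ν > 0`. On a line `Re s
= σ` with `0 < σ < ⌊ν⌋ + 1 - ν` the integral yields that power minus its first `⌊ν⌋ + 1` binomial
terms at infinity (`integral_Gamma_mul_Gamma_mul_cpow_neg`, `integral_outer_vertical`). The circles
around the misplaced poles `-ν + k`, `k ≤ ⌊ν⌋`, contribute residues that restore exactly these terms
(`t6_outer_circle`). Non-integrality of `ν` keeps the two pole families apart and `Γ(-ν)` finite and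
nonzero. -/

theorem Complex.norm_Gamma_le_Gamma_re {z : ℂ} (hz : 0 < z.re) :
    ‖Complex.Gamma z‖ ≤ Real.Gamma z.re := by
  rw [Complex.Gamma_eq_integral hz, Complex.GammaIntegral, Real.Gamma_eq_integral hz]
  refine (norm_integral_le_integral_norm _).trans (le_of_eq ?_)
  refine setIntegral_congr_fun measurableSet_Ioi fun x hx => ?_
  rw [Set.mem_Ioi] at hx
  simp [Complex.norm_cpow_eq_rpow_re_of_pos hx, Complex.norm_exp]

/-- To the right of `0` the bound is `Γ(c)`. Elsewhere the recurrence shifts the line to the right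
at the cost of dividing by `|z| ≥ |c|`; the number of shifts is any `n > -c`. -/
theorem Complex.exists_norm_Gamma_le (c : ℝ) (hc : ∀ k : ℕ, c ≠ -k) :
    ∃ C : ℝ, ∀ v : ℝ, ‖Complex.Gamma (c + v * Complex.I)‖ ≤ C := by
  obtain ⟨n, hn⟩ := exists_nat_gt (-c)
  induction n generalizing c with
  | zero =>
    have hc0 : 0 < c := by simpa using hn
    exact ⟨Real.Gamma c, fun v => by
      simpa using Complex.norm_Gamma_le_Gamma_re (z := c + v * Complex.I) (by simpa using hc0)⟩
  | succ n ih =>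
    obtain ⟨C, hC⟩ := ih (c + 1) (fun k hk => hc (k + 1) (by push_cast; linarith))
      (by push_cast at hn; linarith)
    have hc0 : c ≠ 0 := by simpa using hc 0
    refine ⟨C / |c|, fun v => ?_⟩
    have hz : |c| ≤ ‖(c + v * Complex.I : ℂ)‖ := by
      simpa using Complex.abs_re_le_norm (c + v * Complex.I : ℂ)
    have hz0 : (c + v * Complex.I : ℂ) ≠ 0 := fun h => by
      rw [h, norm_zero] at hz
      exact hc0 (abs_nonpos_iff.1 hz)
    rw [le_div_iff₀ (abs_pos.2 hc0)]
    calc _ ≤ ‖Complex.Gamma (c + v * Complex.I)‖ * ‖(c + v * Complex.I : ℂ)‖ := by gcongr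
      _ = ‖Complex.Gamma ((c + 1 : ℝ) + v * Complex.I)‖ := by
        rw [mul_comm, ← norm_mul, ← Complex.Gamma_add_one _ hz0]; push_cast; ring_nf
      _ ≤ C := hC v

theorem Complex.continuous_Gamma_vertical (c : ℝ) (hc : ∀ k : ℕ, c ≠ -k) :
    Continuous fun v : ℝ => Complex.Gamma (c + v * Complex.I) := by
  rw [continuous_iff_continuousAt]
  intro v
  refine ContinuousAt.comp (f := fun v : ℝ => (c + v * Complex.I : ℂ))
    (g := Complex.Gamma) ?_ (by fun_prop)
  refine (Complex.differentiableAt_Gamma _ fun m hm => hc m ?_).continuousAt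
  simpa using congrArg Complex.re hm

/-- Quadratic decay is enough: `Γ(z) = Γ(z + 2) / (z (z + 1))`, and the numerator is bounded on the
line. -/
theorem Complex.integrable_Gamma_vertical {c : ℝ} (hc : 0 < c) :
    Integrable fun v : ℝ => Complex.Gamma (c + v * Complex.I) := by
  refine (integrable_inv_one_add_sq.const_mul
    (Real.Gamma (c + 2) * (1 + 1 / c ^ 2))).mono'
    (Complex.continuous_Gamma_vertical c fun k hk => ?_).aestronglyMeasurable
    (ae_of_all _ fun v => ?_)
  · have : (0 : ℝ) ≤ k := k.cast_nonneg
    linarith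
  · set z : ℂ := c + v * Complex.I with hz
    have hre : z.re = c := by simp [hz]
    have him : z.im = v := by simp [hz]
    have hz0 : z ≠ 0 := fun h => by rw [h] at hre; simp at hre; linarith
    have hz1 : z + 1 ≠ 0 := fun h => by
      have := congrArg Complex.re h
      simp [hre] at this; linarith
    have h2 : Complex.Gamma (z + 2) = (z + 1) * (z * Complex.Gamma z) := by
      rw [← Complex.Gamma_add_one _ hz0, ← Complex.Gamma_add_one _ hz1]; ring_nf
    have hle : ‖Complex.Gamma (z + 2)‖ ≤ Real.Gamma (c + 2) := by
      simpa [hre] using Complex.norm_Gamma_le_Gamma_re (z := z + 2) (by simp [hre]; linarith)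
    have hn : ‖z‖ ^ 2 = c ^ 2 + v ^ 2 := by
      rw [Complex.sq_norm, Complex.normSq_apply, hre, him]; ring
    have hn1 : ‖z‖ ^ 2 ≤ ‖z + 1‖ ^ 2 := by
      rw [Complex.sq_norm, Complex.sq_norm, Complex.normSq_apply, Complex.normSq_apply]
      simp [hre]; nlinarith
    have hn2 : ‖z‖ ≤ ‖z + 1‖ := by
      simpa using (sq_le_sq₀ (norm_nonneg z) (norm_nonneg _)).1 hn1
    rw [h2, norm_mul, norm_mul] at hle
    have hb : (c ^ 2 + v ^ 2) * ‖Complex.Gamma z‖ ≤ Real.Gamma (c + 2) := by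
      rw [← hn]
      refine le_trans ?_ hle
      rw [pow_two, mul_assoc]
      gcongr
    -- The factor `1 + 1 / c ^ 2` converts decay in `c ^ 2 + v ^ 2` into decay in `1 + v ^ 2`.
    have hkey : (1 + v ^ 2) ≤ (1 + 1 / c ^ 2) * (c ^ 2 + v ^ 2) := by
      have : (1 + 1 / c ^ 2) * (c ^ 2 + v ^ 2) = 1 + v ^ 2 + (c ^ 2 + v ^ 2 / c ^ 2) := by
        field_simp; ring
      rw [this]
      have : 0 ≤ c ^ 2 + v ^ 2 / c ^ 2 := by positivity
      linarith
    rw [← div_eq_mul_inv, le_div_iff₀ (by positivity)]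
    calc _ ≤ ‖Complex.Gamma z‖ * ((1 + 1 / c ^ 2) * (c ^ 2 + v ^ 2)) := by gcongr
      _ = ((c ^ 2 + v ^ 2) * ‖Complex.Gamma z‖) * (1 + 1 / c ^ 2) := by ring
      _ ≤ _ := by gcongr

/-- Gamma factors multiplied along a vertical line, traversed in opposite directions. -/
theorem Complex.integrable_Gamma_mul_Gamma_sub {c : ℝ} (hc : 0 < c) (a : ℝ)
    (ha : ∀ k : ℕ, a - c ≠ -k) :
    Integrable fun v : ℝ =>
      Complex.Gamma (c + v * Complex.I) * Complex.Gamma (a - (c + v * Complex.I)) := by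
  obtain ⟨C, hC⟩ := Complex.exists_norm_Gamma_le (a - c) ha
  have h : ∀ v : ℝ, (a - (c + v * Complex.I) : ℂ) = (a - c : ℝ) + (-v : ℝ) * Complex.I := by
    intro v; push_cast; ring
  refine (Complex.integrable_Gamma_vertical hc).mul_bdd (c := C)
    (Continuous.aestronglyMeasurable ?_) (ae_of_all _ fun v => ?_)
  · simp_rw [h]
    exact (Complex.continuous_Gamma_vertical (a - c) ha).comp continuous_neg
  · rw [h]; exact hC _

/-! ### Mellin transforms -/

/-- Mellin inversion for `exp (-t)`, whose transform is the Gamma function. -/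
theorem integral_exp_neg_mul_vertical {c z : ℝ} (hc : 0 < c) (hz : 0 < z) :
    (∫ v : ℝ, Complex.Gamma (c + v * Complex.I) * (z : ℂ) ^ (-(c + v * Complex.I : ℂ))) =
      2 * Real.pi * Complex.exp (-z) := by
  have hm : ∀ s : ℂ, mellin (fun t : ℝ => Complex.exp (-t)) s = Complex.GammaIntegral s := by
    intro s
    rw [Complex.GammaIntegral_eq_mellin]
    simp
  have key := mellinInv_mellin_eq c (fun t : ℝ => Complex.exp (-t)) hz
    (by
      have := Complex.GammaIntegral_convergent (s := c) (by simpa using hc)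
      rw [MellinConvergent]
      refine this.congr_fun (fun x _ => ?_) measurableSet_Ioi
      simp [mul_comm])
    (by
      refine (Complex.integrable_Gamma_vertical hc).congr (ae_of_all _ fun v => ?_)
      simp only [hm]
      exact Complex.Gamma_eq_integral (by simpa using hc))
    (by fun_prop)
  rw [← key, mellinInv]
  simp only [hm]
  rw [Complex.real_smul, ← mul_assoc]
  have h1 : (2 * Real.pi * ((1 / (2 * Real.pi) : ℝ) : ℂ) : ℂ) = 1 := by
    push_cast
    field_simp
  rw [h1, one_mul]
  refine integral_congr_ae (ae_of_all _ fun v => ?_)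
  simp only [smul_eq_mul]
  rw [Complex.Gamma_eq_integral (by simpa using hc), mul_comm]

theorem mellinConvergent_one_add_rpow_neg {a : ℝ} {q : ℂ} (hq : 0 < q.re) (hqa : q.re < a) :
    MellinConvergent (fun u : ℝ => ((1 + u : ℝ) : ℂ) ^ (-a : ℂ)) q := by
  refine mellinConvergent_of_isBigO_rpow (a := a) (b := 0) ?_ ?_ hqa ?_ hq
  · refine ContinuousOn.locallyIntegrableOn (fun u hu => ?_) measurableSet_Ioi
    rw [Set.mem_Ioi] at hu
    refine (ContinuousAt.cpow (by fun_prop) continuousAt_const ?_).continuousWithinAt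
    exact Or.inl (by simp; linarith)
  · refine Asymptotics.IsBigO.of_bound 1 ?_
    filter_upwards [Filter.eventually_gt_atTop 0] with u hu
    rw [Complex.norm_cpow_eq_rpow_re_of_pos (by linarith), one_mul, Real.norm_of_nonneg
      (by positivity)]
    simp only [Complex.neg_re, Complex.ofReal_re]
    exact Real.rpow_le_rpow_of_nonpos hu (by linarith) (by linarith)
  · refine Asymptotics.IsBigO.of_bound 1 ?_
    filter_upwards [self_mem_nhdsWithin] with u hu
    rw [Set.mem_Ioi] at hu
    rw [Complex.norm_cpow_eq_rpow_re_of_pos (by linarith)]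
    simp only [Complex.neg_re, Complex.ofReal_re, neg_zero, Real.rpow_zero, norm_one, mul_one]
    exact Real.rpow_le_one_of_one_le_of_nonpos (by linarith) (by linarith)

/-- The beta integral over the half line. -/
theorem Gamma_mul_mellin_one_add_rpow_neg {a : ℝ} {q : ℂ} (hq : 0 < q.re) (hqa : q.re < a) :
    Complex.Gamma a * mellin (fun u : ℝ => ((1 + u : ℝ) : ℂ) ^ (-a : ℂ)) q =
      Complex.Gamma q * Complex.Gamma (a - q) := by
  have ha : 0 < a := hq.trans hqa
  -- Integrating `F` over `x` gives `Γ(a) u ^ (q - 1) (1 + u) ^ (-a)`. Integrating over `u` first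
  -- gives `Γ(q) x ^ (a - q - 1) exp (-x)`, whose `x`-integral is `Γ(q) Γ(a - q)`.
  set F : ℝ → ℝ → ℂ := fun u x =>
    (u : ℂ) ^ (q - 1) * ((x : ℂ) ^ (a - 1 : ℂ) * Complex.exp (-((1 + u : ℝ) * x))) with hF
  have hG : ∀ u : ℝ, 0 < u → (∫ x in Set.Ioi (0 : ℝ), F u x) =
      Complex.Gamma a * ((u : ℂ) ^ (q - 1) • ((1 + u : ℝ) : ℂ) ^ (-a : ℂ)) := by
    intro u hu
    have h1u : (0 : ℝ) < 1 + u := by linarith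
    simp only [hF]
    rw [integral_const_mul, Complex.integral_cpow_mul_exp_neg_mul_Ioi (by simpa using ha) h1u,
      one_div, Complex.inv_cpow _ _ (by
        rw [Complex.arg_ofReal_of_nonneg h1u.le]; exact Real.pi_pos.ne), ← Complex.cpow_neg]
    simp only [smul_eq_mul]; ring
  have hG' : ∀ x : ℝ, 0 < x → (∫ u in Set.Ioi (0 : ℝ), F u x) =
      Complex.Gamma q * (Complex.exp (-x) * (x : ℂ) ^ ((a - q) - 1 : ℂ)) := by
    intro x hx
    have : ∀ u : ℝ, F u x = ((x : ℂ) ^ (a - 1 : ℂ) * Complex.exp (-x)) *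
        ((u : ℂ) ^ (q - 1) * Complex.exp (-(x * u))) := by
      intro u
      simp only [hF]
      have : Complex.exp (-((1 + u : ℝ) * x)) = Complex.exp (-x) * Complex.exp (-(x * u)) := by
        rw [← Complex.exp_add]; push_cast; ring_nf
      rw [this]; ring
    simp_rw [this]
    rw [integral_const_mul, Complex.integral_cpow_mul_exp_neg_mul_Ioi hq hx, one_div,
      Complex.inv_cpow _ _ (by
        rw [Complex.arg_ofReal_of_nonneg hx.le]; exact Real.pi_pos.ne), ← Complex.cpow_neg]
    have : (x : ℂ) ^ ((a - q) - 1 : ℂ) = (x : ℂ) ^ (a - 1 : ℂ) * (x : ℂ) ^ (-q) := by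
      rw [← Complex.cpow_add _ _ (by exact_mod_cast hx.ne')]; ring_nf
    rw [this]; ring
  have hmeas : AEStronglyMeasurable (Function.uncurry F)
      ((volume.restrict (Set.Ioi (0 : ℝ))).prod (volume.restrict (Set.Ioi (0 : ℝ)))) := by
    refine Measurable.aestronglyMeasurable ?_
    simp only [hF, Function.uncurry_def]
    fun_prop
  have hint : Integrable (Function.uncurry F)
      ((volume.restrict (Set.Ioi (0 : ℝ))).prod (volume.restrict (Set.Ioi (0 : ℝ)))) := by
    rw [integrable_prod_iff hmeas]
    constructor
    · refine (ae_restrict_iff' measurableSet_Ioi).2 (ae_of_all _ fun u hu => ?_)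
      rw [Set.mem_Ioi] at hu
      -- A non-integrable slice would have integral `0` by default, while `hG` evaluates it to a
      -- nonzero number.
      by_contra hcon
      have h0 := integral_undef (μ := volume.restrict (Set.Ioi (0 : ℝ)))
        (f := fun x => Function.uncurry F (u, x)) hcon
      simp only [Function.uncurry_apply_pair] at h0
      rw [hG u hu] at h0
      have h1u : ((1 + u : ℝ) : ℂ) ≠ 0 := by exact_mod_cast (by linarith : (1 + u) ≠ 0)
      have hu0 : (u : ℂ) ≠ 0 := by exact_mod_cast hu.ne'
      simp [Complex.cpow_eq_zero_iff, hu0,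
        Complex.Gamma_ne_zero_of_re_pos (s := (a : ℂ)) (by simpa using ha)] at h0
      exact h1u (by push_cast; exact h0.1)
    · have hc := (mellin_convergent_iff_norm (T := Set.Ioi 0) subset_rfl measurableSet_Ioi
        (by
          refine ContinuousOn.aestronglyMeasurable (fun u hu => ?_) measurableSet_Ioi
          rw [Set.mem_Ioi] at hu
          refine (ContinuousAt.cpow (by fun_prop) continuousAt_const ?_).continuousWithinAt
          exact Or.inl (by simp; linarith))).1 (mellinConvergent_one_add_rpow_neg hq hqa)
      refine (hc.const_mul (Real.Gamma a)).congr ?_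
      refine (ae_restrict_iff' measurableSet_Ioi).2 (ae_of_all _ fun u hu => ?_)
      rw [Set.mem_Ioi] at hu
      have h1u : (0 : ℝ) < 1 + u := by linarith
      have : ∀ x ∈ Set.Ioi (0 : ℝ), ‖Function.uncurry F (u, x)‖ =
          u ^ (q.re - 1) * (x ^ (a - 1) * Real.exp (-((1 + u) * x))) := by
        intro x hx
        simp only [hF, Function.uncurry_apply_pair, norm_mul]
        rw [Complex.norm_cpow_eq_rpow_re_of_pos hu, Complex.norm_cpow_eq_rpow_re_of_pos hx,
          Complex.norm_exp]
        congr 2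
        simp
      beta_reduce
      rw [setIntegral_congr_fun measurableSet_Ioi this, integral_const_mul,
        Real.integral_rpow_mul_exp_neg_mul_Ioi ha h1u, Complex.norm_cpow_eq_rpow_re_of_pos h1u]
      simp only [Complex.neg_re, Complex.ofReal_re]
      rw [one_div, Real.inv_rpow h1u.le, Real.rpow_neg h1u.le]
      ring
  have hsw := integral_integral_swap hint
  rw [mellin, ← integral_const_mul, ← setIntegral_congr_fun measurableSet_Ioi hG, hsw,
    setIntegral_congr_fun measurableSet_Ioi hG', integral_const_mul]
  congr 1
  rw [Complex.Gamma_eq_integral (by simpa using hqa), Complex.GammaIntegral]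
  exact integral_congr_ae (ae_of_all _ fun x => by simp)

/-! ### The Mellin-Barnes integral of a power of `1 + z` -/

/-- `Γ(η - n)` times the remainder of the binomial series of `(1 + w) ^ (n - η)` after `n` terms. -/
noncomputable def binomialRemainder (η : ℝ) (n : ℕ) (w : ℝ) : ℝ :=
  Real.Gamma (η - n) * (1 + w) ^ (n - η) -
    ∑ k ∈ Finset.range n, (-1) ^ k / k.factorial * Real.Gamma (k + η - n) * w ^ k

theorem continuousOn_binomialRemainder (η : ℝ) (n : ℕ) :
    ContinuousOn (binomialRemainder η n) (Set.Ici 0) := by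
  intro w hw
  rw [Set.mem_Ici] at hw
  have h1w : 1 + w ≠ 0 := by linarith
  unfold binomialRemainder
  exact ContinuousAt.continuousWithinAt
    ((continuousAt_const.mul (ContinuousAt.rpow_const (by fun_prop) (Or.inl h1w))).sub
      (by fun_prop))

/-- Differentiation lowers the exponent by one, kills the constant term of the sum and shifts the
index of the others. The factor `n + 1 - η` is absorbed by the Gamma recurrence, which produces the
minus sign. -/
theorem hasDerivAt_binomialRemainder_succ {η : ℝ} (hη : ∀ k : ℤ, η ≠ k) (n : ℕ) {w : ℝ}
    (hw : 0 ≤ w) :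
    HasDerivAt (binomialRemainder η (n + 1)) (-binomialRemainder η n w) w := by
  have hΓ : Real.Gamma (η - n) = (η - (n + 1 : ℕ)) * Real.Gamma (η - (n + 1 : ℕ)) := by
    rw [← Real.Gamma_add_one (fun h => hη (n + 1 : ℕ) (by push_cast at h ⊢; linarith))]
    push_cast; ring_nf
  have h1 : HasDerivAt (fun w : ℝ => (1 + w) ^ (((n + 1 : ℕ) : ℝ) - η))
      ((((n + 1 : ℕ) : ℝ) - η) * (1 + w) ^ ((n : ℝ) - η)) w := by
    have := ((hasDerivAt_id w).const_add 1).rpow_const (p := ((n + 1 : ℕ) : ℝ) - η)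
      (Or.inl (by simp; linarith))
    simp only [id] at this
    refine this.congr_deriv ?_
    push_cast
    ring_nf
  have h2 : HasDerivAt (fun w : ℝ => ∑ k ∈ Finset.range (n + 1),
      (-1) ^ k / k.factorial * Real.Gamma (k + η - (n + 1 : ℕ)) * w ^ k)
      (∑ k ∈ Finset.range (n + 1),
      (-1) ^ k / k.factorial * Real.Gamma (k + η - (n + 1 : ℕ)) * (k * w ^ (k - 1))) w := by
    refine HasDerivAt.fun_sum fun k _ => ?_
    exact (hasDerivAt_pow k w).const_mul _
  refine ((h1.const_mul (Real.Gamma (η - (n + 1 : ℕ)))).sub h2).congr_deriv ?_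
  rw [Finset.sum_range_succ', binomialRemainder, hΓ]
  simp only [Nat.cast_zero, zero_mul, mul_zero, add_zero, add_tsub_cancel_right]
  have h3 : ∀ k : ℕ, (-1 : ℝ) ^ (k + 1) / (k + 1).factorial *
      Real.Gamma ((k + 1 : ℕ) + η - (n + 1 : ℕ)) * ((k + 1 : ℕ) * w ^ k) =
      -((-1) ^ k / k.factorial * Real.Gamma (k + η - n) * w ^ k) := by
    intro k
    have h : ((k + 1 : ℕ) + η - (n + 1 : ℕ) : ℝ) = k + η - n := by push_cast; ring
    rw [h, Nat.factorial_succ]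
    have : (k.factorial : ℝ) ≠ 0 := by positivity
    push_cast
    field_simp
    ring
  simp_rw [h3]
  rw [Finset.sum_neg_distrib]
  ring

theorem integral_binomialRemainder {η : ℝ} (hη : ∀ k : ℤ, η ≠ k) (n : ℕ) {w : ℝ}
    (hw : 0 ≤ w) :
    binomialRemainder η (n + 1) w = -∫ x in (0 : ℝ)..w, binomialRemainder η n x := by
  have h := intervalIntegral.integral_eq_sub_of_hasDerivAt (a := 0) (b := w)
    (f := binomialRemainder η (n + 1)) (f' := fun x => -binomialRemainder η n x)
    (fun x hx => hasDerivAt_binomialRemainder_succ hη n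
      (by rw [Set.uIcc_of_le hw] at hx; exact hx.1))
    (((continuousOn_binomialRemainder η n).neg.mono fun x hx => by
      rw [Set.uIcc_of_le hw] at hx; exact hx.1).intervalIntegrable)
  -- The `k = 0` term of the sum is the value of the power at `0`; this needs at least one
  -- subtracted term.
  have h0 : binomialRemainder η (n + 1) 0 = 0 := by
    rw [binomialRemainder, Finset.sum_range_succ']
    simp
  rw [h0, sub_zero, intervalIntegral.integral_neg] at h
  exact h.symm

/-- Mellin inversion of the beta integral; the strip `0 < σ < η` is where the two pole families are
separated by a straight line. -/
theorem integral_Gamma_mul_Gamma_sub_mul_cpow {η σ : ℝ} (hσ : 0 < σ) (hση : σ < η)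
    {z : ℝ} (hz : 0 < z) :
    (∫ v : ℝ, Complex.Gamma (σ + v * Complex.I) * Complex.Gamma (η - (σ + v * Complex.I)) *
      (z : ℂ) ^ (-(σ + v * Complex.I : ℂ))) =
      2 * Real.pi * (Complex.Gamma η * ((1 + z : ℝ) : ℂ) ^ (-η : ℂ)) := by
  have hΓ : Complex.Gamma η ≠ 0 :=
    Complex.Gamma_ne_zero_of_re_pos (by simpa using hσ.trans hση)
  have hm : ∀ v : ℝ, mellin (fun u : ℝ => ((1 + u : ℝ) : ℂ) ^ (-η : ℂ)) (σ + v * Complex.I) =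
      (Complex.Gamma η)⁻¹ * (Complex.Gamma (σ + v * Complex.I) *
        Complex.Gamma (η - (σ + v * Complex.I))) := by
    intro v
    rw [← Gamma_mul_mellin_one_add_rpow_neg (by simpa using hσ) (by simpa using hση),
      inv_mul_cancel_left₀ hΓ]
  have key := mellinInv_mellin_eq σ (fun u : ℝ => ((1 + u : ℝ) : ℂ) ^ (-η : ℂ)) hz
    (mellinConvergent_one_add_rpow_neg (by simpa using hσ) (by simpa using hση))
    (by
      simp only [Complex.VerticalIntegrable, hm]
      refine (Complex.integrable_Gamma_mul_Gamma_sub hσ η fun k hk => ?_).const_mul _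
      have : (0 : ℝ) ≤ k := k.cast_nonneg
      linarith)
    (ContinuousAt.cpow (by fun_prop) continuousAt_const (Or.inl (by simp; linarith)))
  rw [← key, mellinInv]
  simp only [hm, Complex.real_smul, smul_eq_mul]
  have : ∀ v : ℝ, (z : ℂ) ^ (-(σ + v * Complex.I : ℂ)) * ((Complex.Gamma η)⁻¹ *
      (Complex.Gamma (σ + v * Complex.I) * Complex.Gamma (η - (σ + v * Complex.I)))) =
      (Complex.Gamma η)⁻¹ * (Complex.Gamma (σ + v * Complex.I) *
        Complex.Gamma (η - (σ + v * Complex.I)) * (z : ℂ) ^ (-(σ + v * Complex.I : ℂ))) := by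
    intro v; ring
  simp_rw [this]
  rw [integral_const_mul]
  push_cast
  rw [← mul_assoc, ← mul_assoc, ← mul_assoc]
  have hc : (2 * Real.pi * Complex.Gamma η * (1 / (2 * Real.pi)) * (Complex.Gamma η)⁻¹ : ℂ) = 1 := by
    field_simp
  rw [hc, one_mul]

/-- Justifies the interchanges of an integral over an interval or half line with one over a vertical
line. -/
theorem integrable_restrict_prod_of_norm_le {s : Set ℝ} (hs : MeasurableSet s) {F : ℝ × ℝ → ℂ}
    {g h : ℝ → ℝ} (hg : IntegrableOn g s) (hh : Integrable h)
    (hF : AEStronglyMeasurable F ((volume.restrict s).prod volume))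
    (hle : ∀ x ∈ s, ∀ v, ‖F (x, v)‖ ≤ g x * h v) :
    Integrable F ((volume.restrict s).prod volume) := by
  refine (hg.mul_prod hh).mono' hF ?_
  have h : (volume.restrict s).prod (volume : Measure ℝ) =
      (volume.prod volume).restrict (s ×ˢ Set.univ) := by
    rw [← Measure.prod_restrict, Measure.restrict_univ]
  rw [h, ae_restrict_iff' (hs.prod MeasurableSet.univ)]
  exact ae_of_all _ fun p hp => hle p.1 hp.1 p.2

/-- Induction on `n` with the line kept fixed, so that no contour has to be moved. Integrating over
`(0, w)` raises the exponent of `w` by one and divides by `s + n + 1 - η`, which the recurrence for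
`Γ(η - n - s)` absorbs up to sign; the right-hand side obeys the same relation by
`integral_binomialRemainder`. The variable is `w = 1/z` because the powers then have real exponent
`σ + n - η > -1` and are integrable at `0`. -/
theorem integral_Gamma_mul_Gamma_eq_binomialRemainder {η σ : ℝ} (hσ : 0 < σ) (hση : σ < η)
    (hη : η < 1) (n : ℕ) {w : ℝ} (hw : 0 < w) :
    (∫ v : ℝ, Complex.Gamma (σ + v * Complex.I) *
      Complex.Gamma ((η - n : ℝ) - (σ + v * Complex.I)) *
      (w : ℂ) ^ ((σ + v * Complex.I : ℂ) + n - η)) =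
      2 * Real.pi * binomialRemainder η n w := by
  have hηk : ∀ k : ℤ, η ≠ k := by
    intro k hk
    have h0 : (0 : ℝ) < k := by linarith
    have h1 : (k : ℝ) < 1 := by linarith
    norm_cast at h0 h1
    omega
  induction n generalizing w with
  | zero =>
    -- The base case rests on `(1 + w) ^ (-η) = w ^ (-η) (1 + 1/w) ^ (-η)`.
    have h := integral_Gamma_mul_Gamma_sub_mul_cpow hσ hση (inv_pos.2 hw)
    have hw0 : (w : ℂ) ≠ 0 := by exact_mod_cast hw.ne'
    have e : ∀ v : ℝ, Complex.Gamma (σ + v * Complex.I) *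
        Complex.Gamma ((η - (0 : ℕ) : ℝ) - (σ + v * Complex.I)) *
        (w : ℂ) ^ ((σ + v * Complex.I : ℂ) + (0 : ℕ) - η) =
        (w : ℂ) ^ (-η : ℂ) * (Complex.Gamma (σ + v * Complex.I) *
          Complex.Gamma (η - (σ + v * Complex.I)) *
          ((w⁻¹ : ℝ) : ℂ) ^ (-(σ + v * Complex.I : ℂ))) := by
      intro v
      rw [Complex.ofReal_inv, Complex.inv_cpow _ _ (by
        rw [Complex.arg_ofReal_of_nonneg hw.le]; exact Real.pi_pos.ne), ← Complex.cpow_neg,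
        neg_neg]
      have : (w : ℂ) ^ ((σ + v * Complex.I : ℂ) + (0 : ℕ) - η) =
          (w : ℂ) ^ (σ + v * Complex.I : ℂ) * (w : ℂ) ^ (-η : ℂ) := by
        rw [← Complex.cpow_add _ _ hw0]; push_cast; ring_nf
      rw [this]
      push_cast
      ring_nf
    simp_rw [e]
    rw [integral_const_mul, h, binomialRemainder]
    simp only [Finset.range_zero, Finset.sum_empty, sub_zero, Nat.cast_zero, zero_sub]
    push_cast
    rw [Complex.ofReal_cpow (by linarith), ← Complex.Gamma_ofReal]
    have h2 : ((1 + w : ℝ) : ℂ) = (w : ℂ) * ((1 + w⁻¹ : ℝ) : ℂ) := by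
      push_cast; field_simp; ring
    rw [h2, Complex.mul_cpow_ofReal_nonneg hw.le (by positivity)]
    push_cast
    ring
  | succ n ih =>
    set H : ℝ → ℂ := fun v => Complex.Gamma (σ + v * Complex.I) *
      Complex.Gamma ((η - n : ℝ) - (σ + v * Complex.I)) with hH
    have hHint : Integrable H := by
      refine Complex.integrable_Gamma_mul_Gamma_sub hσ _ fun k hk => ?_
      rcases Nat.lt_or_ge k n with h | h
      · have : (k : ℝ) + 1 ≤ n := by exact_mod_cast h
        linarith
      · have : (n : ℝ) ≤ k := by exact_mod_cast h
        linarith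
    rw [integral_binomialRemainder hηk n hw.le]
    push_cast
    rw [← intervalIntegral.integral_ofReal, mul_neg, ← intervalIntegral.integral_const_mul,
      intervalIntegral.integral_of_le hw.le]
    rw [← setIntegral_congr_fun measurableSet_Ioc
      (fun x hx => ih (w := x) hx.1)]
    rw [integral_integral_swap]
    · rw [← integral_neg]
      refine integral_congr_ae (ae_of_all _ fun v => ?_)
      beta_reduce
      rw [integral_const_mul, ← intervalIntegral.integral_of_le hw.le,
        integral_cpow (Or.inl (by simp; linarith))]
      set s : ℂ := σ + v * Complex.I with hs
      have hne : (η - n - 1 : ℂ) - s ≠ 0 := by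
        intro h
        have := congrArg Complex.re h
        simp [hs] at this
        linarith
      have hΓ : Complex.Gamma ((η - n : ℝ) - s) =
          ((η - n - 1 : ℂ) - s) * Complex.Gamma ((η - n - 1 : ℂ) - s) := by
        rw [← Complex.Gamma_add_one _ hne]; push_cast; ring_nf
      have hne2 : (s + n - η + 1 : ℂ) ≠ 0 := by
        intro h; apply hne; linear_combination -h
      have h0 : ((0 : ℝ) : ℂ) ^ (s + n - η + 1 : ℂ) = 0 := by
        rw [Complex.ofReal_zero, Complex.zero_cpow hne2]
      have e1 : (η : ℂ) - (n + 1) - s = η - n - 1 - s := by ring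
      have e2 : s + (n + 1) - η = s + n - η + 1 := by ring
      rw [hΓ, h0, e1, e2]
      field_simp
      ring
    · have hpow : IntegrableOn (fun x : ℝ => x ^ (σ + n - η)) (Set.Ioc 0 w) := by
        rw [← intervalIntegrable_iff_integrableOn_Ioc_of_le hw.le]
        exact intervalIntegral.intervalIntegrable_rpow' (by
          have : (0 : ℝ) ≤ n := n.cast_nonneg
          linarith)
      refine integrable_restrict_prod_of_norm_le measurableSet_Ioc hpow hHint.norm ?_ ?_
      · refine AEStronglyMeasurable.mul (f := fun p : ℝ × ℝ => H p.2)
          hHint.aestronglyMeasurable.comp_snd (Measurable.aestronglyMeasurable ?_)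
        fun_prop
      · intro x hx v
        simp only [Function.uncurry_apply_pair]
        rw [norm_mul, Complex.norm_cpow_eq_rpow_re_of_pos hx.1, mul_comm]
        simp [hH]

/-- Mellin-Barnes representation of `(1 + z) ^ (n - η)`, with the contributions of the poles of
`Γ(η - n - s)` on the left of the contour. -/
theorem integral_Gamma_mul_Gamma_mul_cpow_neg {η σ : ℝ} (hσ : 0 < σ) (hση : σ < η)
    (hη : η < 1) (n : ℕ) {z : ℝ} (hz : 0 < z) :
    (∫ v : ℝ, Complex.Gamma (σ + v * Complex.I) *
      Complex.Gamma ((η - n : ℝ) - (σ + v * Complex.I)) * (z : ℂ) ^ (-(σ + v * Complex.I : ℂ))) =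
      2 * Real.pi * ((Real.Gamma (η - n) * (1 + z) ^ (n - η) -
        ∑ k ∈ Finset.range n, (-1) ^ k / k.factorial * Real.Gamma (k + η - n) *
          z ^ (n - η - k) : ℝ) : ℂ) := by
  have h := integral_Gamma_mul_Gamma_eq_binomialRemainder hσ hση hη n (inv_pos.2 hz)
  have hz0 : (z : ℂ) ≠ 0 := by exact_mod_cast hz.ne'
  have e : ∀ v : ℝ, Complex.Gamma (σ + v * Complex.I) *
      Complex.Gamma ((η - n : ℝ) - (σ + v * Complex.I)) *
        (z : ℂ) ^ (-(σ + v * Complex.I : ℂ)) =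
      ((z ^ (n - η : ℝ) : ℝ) : ℂ) * (Complex.Gamma (σ + v * Complex.I) *
      Complex.Gamma ((η - n : ℝ) - (σ + v * Complex.I)) *
        ((z⁻¹ : ℝ) : ℂ) ^ ((σ + v * Complex.I : ℂ) + n - η)) := by
    intro v
    rw [Complex.ofReal_inv, Complex.inv_cpow _ _ (by
      rw [Complex.arg_ofReal_of_nonneg hz.le]; exact Real.pi_pos.ne), ← Complex.cpow_neg,
      Complex.ofReal_cpow hz.le]
    have : (z : ℂ) ^ (-(σ + v * Complex.I : ℂ)) =
        (z : ℂ) ^ ((n - η : ℝ) : ℂ) * (z : ℂ) ^ (-((σ + v * Complex.I : ℂ) + n - η)) := by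
      rw [← Complex.cpow_add _ _ hz0]; push_cast; ring_nf
    rw [this]
    ring
  simp_rw [e]
  rw [integral_const_mul, h, mul_left_comm, ← Complex.ofReal_mul]
  congr 2
  rw [binomialRemainder, mul_sub, Finset.mul_sum]
  congr 1
  · have : (1 + z) = z * (1 + z⁻¹) := by field_simp; ring
    rw [this, Real.mul_rpow hz.le (by positivity)]
    ring
  · refine Finset.sum_congr rfl fun k _ => ?_
    rw [Real.rpow_sub hz (n - η) k, Real.rpow_natCast, inv_pow]
    ring

/-! ### Mellin transforms of exponentially decaying functions -/

/-- Bounded nonnegative continuous functions on the open half line. -/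
structure BoundedWeight (W : ℝ → ℝ) (C : ℝ) : Prop where
  continuousOn : ContinuousOn W (Set.Ioi 0)
  nonneg : ∀ u, 0 < u → 0 ≤ W u
  le : ∀ u, 0 < u → W u ≤ C

/-- The Mellin transform of `u ↦ exp (-y u) W u`. -/
noncomputable def expMellin (y : ℝ) (W : ℝ → ℝ) (q : ℂ) : ℂ :=
  mellin (fun u : ℝ => ((Real.exp (-(y * u)) * W u : ℝ) : ℂ)) q

/-- These are the hypotheses of the convergence and differentiability criteria for Mellin transforms
of exponentially decaying functions. -/
theorem BoundedWeight.mellin_aux {W : ℝ → ℝ} {C : ℝ} (hW : BoundedWeight W C) {y : ℝ} :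
    LocallyIntegrableOn (fun u : ℝ => ((Real.exp (-(y * u)) * W u : ℝ) : ℂ)) (Set.Ioi 0) ∧
    (fun u : ℝ => ((Real.exp (-(y * u)) * W u : ℝ) : ℂ)) =O[Filter.atTop]
      (fun u => Real.exp (-y * u)) ∧
    (0 < y → (fun u : ℝ => ((Real.exp (-(y * u)) * W u : ℝ) : ℂ)) =O[nhdsWithin 0 (Set.Ioi 0)]
      (fun u : ℝ => u ^ (-(0 : ℝ)))) := by
  refine ⟨?_, ?_, fun hy => ?_⟩
  · refine ContinuousOn.locallyIntegrableOn ?_ measurableSet_Ioi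
    refine Complex.continuous_ofReal.comp_continuousOn (ContinuousOn.mul ?_ hW.continuousOn)
    fun_prop
  · refine Asymptotics.IsBigO.of_bound C ?_
    filter_upwards [Filter.eventually_gt_atTop 0] with u hu
    rw [Complex.norm_real, norm_mul, Real.norm_of_nonneg (Real.exp_pos _).le,
      Real.norm_of_nonneg (hW.nonneg u hu), Real.norm_of_nonneg (Real.exp_pos _).le, mul_comm,
      neg_mul]
    exact mul_le_mul_of_nonneg_right (hW.le u hu) (Real.exp_pos _).le
  · refine Asymptotics.IsBigO.of_bound C ?_
    filter_upwards [self_mem_nhdsWithin] with u hu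
    rw [Set.mem_Ioi] at hu
    rw [Complex.norm_real, norm_mul, Real.norm_of_nonneg (Real.exp_pos _).le,
      Real.norm_of_nonneg (hW.nonneg u hu), neg_zero, Real.rpow_zero, norm_one, mul_one]
    calc _ ≤ 1 * C := mul_le_mul (Real.exp_le_one_iff.2 (by nlinarith)) (hW.le u hu)
            (hW.nonneg u hu) zero_le_one
      _ = C := one_mul C

theorem BoundedWeight.mellinConvergent {W : ℝ → ℝ} {C : ℝ} (hW : BoundedWeight W C) {y : ℝ}
    (hy : 0 < y) {q : ℂ} (hq : 0 < q.re) :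
    MellinConvergent (fun u : ℝ => ((Real.exp (-(y * u)) * W u : ℝ) : ℂ)) q :=
  mellinConvergent_of_isBigO_rpow_exp hy hW.mellin_aux.1 hW.mellin_aux.2.1
    (hW.mellin_aux.2.2 hy) hq

theorem BoundedWeight.differentiableAt_expMellin {W : ℝ → ℝ} {C : ℝ} (hW : BoundedWeight W C)
    {y : ℝ} (hy : 0 < y) {q : ℂ} (hq : 0 < q.re) : DifferentiableAt ℂ (expMellin y W) q :=
  mellin_differentiableAt_of_isBigO_rpow_exp hy hW.mellin_aux.1 hW.mellin_aux.2.1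
    (hW.mellin_aux.2.2 hy) hq

theorem BoundedWeight.integrableOn {W : ℝ → ℝ} {C : ℝ} (hW : BoundedWeight W C) {y : ℝ}
    (hy : 0 < y) {r : ℝ} (hr : 0 < r) :
    IntegrableOn (fun u : ℝ => u ^ (r - 1) * (Real.exp (-(y * u)) * W u)) (Set.Ioi 0) := by
  have h := (mellin_convergent_iff_norm (T := Set.Ioi 0) subset_rfl measurableSet_Ioi
    hW.mellin_aux.1.aestronglyMeasurable).1 (hW.mellinConvergent hy (q := r) (by simpa using hr))
  refine h.congr_fun (fun u hu => ?_) measurableSet_Ioi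
  simp only [Complex.ofReal_re]
  rw [Complex.norm_real, Real.norm_of_nonneg
    (mul_nonneg (Real.exp_pos _).le (hW.nonneg u hu))]

theorem expMellin_ofReal (y : ℝ) (W : ℝ → ℝ) (r : ℝ) :
    expMellin y W r =
      ((∫ u in Set.Ioi (0 : ℝ), u ^ (r - 1) * (Real.exp (-(y * u)) * W u) : ℝ) : ℂ) := by
  rw [expMellin, mellin, ← integral_complex_ofReal]
  refine setIntegral_congr_fun measurableSet_Ioi fun u hu => ?_
  simp only [smul_eq_mul]
  rw [Complex.ofReal_mul (u ^ (r - 1)), Complex.ofReal_cpow (le_of_lt hu)]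
  push_cast
  rfl

theorem BoundedWeight.norm_expMellin_le {W : ℝ → ℝ} {C : ℝ} (hW : BoundedWeight W C) (y : ℝ)
    (q : ℂ) :
    ‖expMellin y W q‖ ≤
      ∫ u in Set.Ioi (0 : ℝ), u ^ (q.re - 1) * (Real.exp (-(y * u)) * W u) := by
  rw [expMellin, mellin]
  refine (norm_integral_le_integral_norm _).trans (le_of_eq ?_)
  refine setIntegral_congr_fun measurableSet_Ioi fun u hu => ?_
  simp only [smul_eq_mul]
  rw [norm_mul, Complex.norm_cpow_eq_rpow_re_of_pos hu, Complex.norm_real,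
    Real.norm_of_nonneg (mul_nonneg (Real.exp_pos _).le (hW.nonneg u hu))]
  simp

theorem boundedWeight_one_add_rpow_neg {ν : ℝ} (hν : 0 ≤ ν) :
    BoundedWeight (fun u => (1 + u) ^ (-ν)) 1 where
  continuousOn u hu := by
    rw [Set.mem_Ioi] at hu
    exact (ContinuousAt.rpow_const (by fun_prop) (Or.inl (by linarith))).continuousWithinAt
  nonneg u hu := by positivity
  le u hu := Real.rpow_le_one_of_one_le_of_nonpos (by linarith) (by linarith)

/-- The weight of the final Laplace integral; it is bounded since `1 + x u ≤ (1 + x) (1 + u)`. -/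
theorem boundedWeight_one_add_mul_rpow {ν x : ℝ} (hν : 0 ≤ ν) (hx : 0 < x) :
    BoundedWeight (fun u => (1 + u) ^ (-ν) * (1 + x * u) ^ ν) ((1 + x) ^ ν) where
  continuousOn u hu := by
    rw [Set.mem_Ioi] at hu
    have : 0 < x * u := mul_pos hx hu
    exact ((ContinuousAt.rpow_const (by fun_prop) (Or.inl (by linarith))).mul
      (ContinuousAt.rpow_const (by fun_prop) (Or.inl (by linarith)))).continuousWithinAt
  nonneg u hu := by positivity
  le u hu := by
    have h1 : (1 + x * u) ^ ν ≤ ((1 + x) * (1 + u)) ^ ν :=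
      Real.rpow_le_rpow (by positivity) (by nlinarith) hν
    rw [Real.mul_rpow (by positivity) (by positivity)] at h1
    rw [Real.rpow_neg (by positivity), inv_mul_le_iff₀ (by positivity)]
    linarith

/-! ### The two iterated integrals -/

/-- On the line, `Γ(t)` is integrable and the other two Gamma factors are bounded, their arguments
having constant positive real part. -/
theorem integrable_inner_vertical {ν c y : ℝ} {q : ℂ} (hc : 0 < c) (hcq : c < q.re)
    (hqν : q.re - ν < c) (hy : 0 < y) :
    Integrable fun v : ℝ => Complex.Gamma (ν - q + (c + v * Complex.I)) *
      Complex.Gamma (q - (c + v * Complex.I)) * Complex.Gamma (c + v * Complex.I) *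
        (y : ℂ) ^ (-(c + v * Complex.I : ℂ)) := by
  have hB1 : ∀ v : ℝ, ‖Complex.Gamma (ν - q + (c + v * Complex.I))‖ ≤
      Real.Gamma (ν - q.re + c) := fun v => by
    simpa using Complex.norm_Gamma_le_Gamma_re (z := ν - q + (c + v * Complex.I))
      (by simp; linarith)
  have hB2 : ∀ v : ℝ, ‖Complex.Gamma (q - (c + v * Complex.I))‖ ≤ Real.Gamma (q.re - c) :=
    fun v => by
      simpa using Complex.norm_Gamma_le_Gamma_re (z := q - (c + v * Complex.I))
        (by simp; linarith)
  have hcont : ∀ g : ℝ → ℂ, Continuous g → (∀ v, 0 < (g v).re) →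
      Continuous fun v => Complex.Gamma (g v) := by
    intro g hg hpos
    rw [continuous_iff_continuousAt]
    intro v
    refine ContinuousAt.comp (f := g) (g := Complex.Gamma) ?_ hg.continuousAt
    refine (Complex.differentiableAt_Gamma _ fun m hm => ?_).continuousAt
    have := hpos v
    rw [hm] at this
    simp at this
    have : (0 : ℝ) ≤ m := m.cast_nonneg
    linarith
  have h := (Complex.integrable_Gamma_vertical hc).bdd_mul
    (f := fun v : ℝ => Complex.Gamma (ν - q + (c + v * Complex.I)) *
      Complex.Gamma (q - (c + v * Complex.I)) * (y : ℂ) ^ (-(c + v * Complex.I : ℂ)))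
    (c := Real.Gamma (ν - q.re + c) * Real.Gamma (q.re - c) * y ^ (-c))
    (Continuous.aestronglyMeasurable ?_) (ae_of_all _ fun v => ?_)
  · refine h.congr (ae_of_all _ fun v => ?_)
    simp only
    ring
  · refine ((hcont _ (by fun_prop) fun v => ?_).mul (hcont _ (by fun_prop) fun v => ?_)).mul
      (Continuous.const_cpow (by fun_prop) (Or.inl (by exact_mod_cast hy.ne')))
    · simp; linarith
    · simp; linarith
  · rw [norm_mul, norm_mul, Complex.norm_cpow_eq_rpow_re_of_pos hy]
    have : (-(c + v * Complex.I : ℂ)).re = -c := by simp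
    rw [this]
    have h0 : 0 < Real.Gamma (ν - q.re + c) := Real.Gamma_pos_of_pos (by linarith)
    gcongr
    · exact hB1 v
    · exact hB2 v

/-- The conditions on `c` put `q - t` in the strip `0 < Re < ν` of the beta integral. After
interchanging, `Γ(t) (y u) ^ (-t)` integrates over the line to `2π exp (-y u)`. -/
theorem integral_inner_vertical {ν c y : ℝ} {q : ℂ} (hc : 0 < c) (hcq : c < q.re)
    (hqν : q.re - ν < c) (hy : 0 < y) :
    (∫ v : ℝ, Complex.Gamma (ν - q + (c + v * Complex.I)) *
      Complex.Gamma (q - (c + v * Complex.I)) * Complex.Gamma (c + v * Complex.I) *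
        (y : ℂ) ^ (-(c + v * Complex.I : ℂ))) =
      2 * Real.pi * (Complex.Gamma ν * expMellin y (fun u => (1 + u) ^ (-ν)) q) := by
  set t : ℝ → ℂ := fun v => c + v * Complex.I with ht
  set F : ℝ → ℝ → ℂ := fun u v => (u : ℂ) ^ (q - 1) * (((1 + u) ^ (-ν) : ℝ) : ℂ) *
    (Complex.Gamma (t v) * ((y * u : ℝ) : ℂ) ^ (-t v)) with hF
  have h1 : ∀ v : ℝ, Complex.Gamma (ν - q + t v) * Complex.Gamma (q - t v) *
      Complex.Gamma (t v) * (y : ℂ) ^ (-t v) =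
      Complex.Gamma ν * ∫ u in Set.Ioi (0 : ℝ), F u v := by
    intro v
    have hb := Gamma_mul_mellin_one_add_rpow_neg (a := ν) (q := q - t v)
      (by simp [ht]; linarith) (by simp [ht]; linarith)
    have e : (ν : ℂ) - (q - t v) = ν - q + t v := by ring
    rw [e] at hb
    rw [mul_comm (Complex.Gamma (ν - q + t v)), ← hb, mellin, mul_assoc, mul_assoc,
      ← integral_mul_const]
    congr 1
    refine setIntegral_congr_fun measurableSet_Ioi fun u hu => ?_
    rw [Set.mem_Ioi] at hu
    have hu0 : (u : ℂ) ≠ 0 := by exact_mod_cast hu.ne'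
    simp only [hF, smul_eq_mul]
    rw [Complex.ofReal_mul, Complex.mul_cpow_ofReal_nonneg hy.le hu.le,
      Complex.ofReal_cpow (by linarith)]
    have : (u : ℂ) ^ (q - t v - 1) = (u : ℂ) ^ (q - 1) * (u : ℂ) ^ (-t v) := by
      rw [← Complex.cpow_add _ _ hu0]; ring_nf
    rw [this]
    push_cast
    ring
  have h2 : ∀ u ∈ Set.Ioi (0 : ℝ), (∫ v : ℝ, F u v) =
      2 * Real.pi * ((u : ℂ) ^ (q - 1) •
        ((Real.exp (-(y * u)) * (1 + u) ^ (-ν) : ℝ) : ℂ)) := by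
    intro u hu
    rw [Set.mem_Ioi] at hu
    simp only [hF, ht]
    rw [integral_const_mul, integral_exp_neg_mul_vertical hc (mul_pos hy hu)]
    push_cast
    simp only [smul_eq_mul]
    ring
  have hint : Integrable (Function.uncurry F)
      ((volume.restrict (Set.Ioi (0 : ℝ))).prod volume) := by
    have hg := (mellin_convergent_iff_norm (T := Set.Ioi 0) subset_rfl measurableSet_Ioi
      (by
        refine ContinuousOn.aestronglyMeasurable (fun u hu => ?_) measurableSet_Ioi
        rw [Set.mem_Ioi] at hu
        refine (ContinuousAt.cpow (by fun_prop) continuousAt_const ?_).continuousWithinAt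
        exact Or.inl (by simp; linarith))).1 (mellinConvergent_one_add_rpow_neg (a := ν)
          (q := q - c) (by simpa using hcq) (by simp; linarith))
    refine integrable_restrict_prod_of_norm_le measurableSet_Ioi (hg.const_mul (y ^ (-c)))
      (Complex.integrable_Gamma_vertical hc).norm ?_ ?_
    · have : AEStronglyMeasurable (fun v => Complex.Gamma (t v)) volume :=
        (Complex.integrable_Gamma_vertical hc).aestronglyMeasurable
      simp only [hF, Function.uncurry_def]
      refine AEStronglyMeasurable.mul (Measurable.aestronglyMeasurable (by fun_prop))
        (AEStronglyMeasurable.mul this.comp_snd (Measurable.aestronglyMeasurable ?_))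
      simp only [ht]
      fun_prop
    · intro u hu v
      rw [Set.mem_Ioi] at hu
      have h1u : 0 < 1 + u := by linarith
      simp only [hF, Function.uncurry_apply_pair, norm_mul]
      rw [Complex.norm_cpow_eq_rpow_re_of_pos hu,
        Complex.norm_cpow_eq_rpow_re_of_pos (mul_pos hy hu),
        Complex.norm_cpow_eq_rpow_re_of_pos h1u, Complex.norm_real,
        Real.norm_of_nonneg (by positivity)]
      have e1 : (-t v).re = -c := by simp [ht]
      have e2 : (q - c).re - 1 = (q - 1).re + (-c) := by simp; ring
      rw [e1, e2, Real.rpow_add hu, Real.mul_rpow hy.le hu.le]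
      simp only [Complex.neg_re, Complex.ofReal_re]
      exact le_of_eq (by ring)
  have hsw := integral_integral_swap hint
  refine (integral_congr_ae (ae_of_all _ h1)).trans ?_
  rw [integral_const_mul, ← hsw, setIntegral_congr_fun measurableSet_Ioi h2,
    integral_const_mul, expMellin, mellin]
  ring

/-- The Gamma pair is integrable, and `expMellin` is bounded on a vertical line by its value at the
real abscissa. -/
theorem integrable_outer_vertical {ν σ α x y : ℝ} {W : ℝ → ℝ} {C : ℝ} (hW : BoundedWeight W C)
    (hσ : 0 < σ) (hσα : σ < α) (hσν : ∀ k : ℕ, -ν - σ ≠ -k) (hx : 0 < x) (hy : 0 < y) :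
    Integrable fun v : ℝ => Complex.Gamma (σ + v * Complex.I) *
      Complex.Gamma (-ν - (σ + v * Complex.I)) * (x : ℂ) ^ (-(σ + v * Complex.I : ℂ)) *
        expMellin y W (α - (σ + v * Complex.I)) := by
  have h0 := Complex.integrable_Gamma_mul_Gamma_sub hσ (-ν) hσν
  rw [Complex.ofReal_neg] at h0
  have h := h0.mul_bdd
    (g := fun v : ℝ => (x : ℂ) ^ (-(σ + v * Complex.I : ℂ)) *
      expMellin y W (α - (σ + v * Complex.I)))
    (c := x ^ (-σ) *
      ∫ u in Set.Ioi (0 : ℝ), u ^ (α - σ - 1) * (Real.exp (-(y * u)) * W u))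
    (Continuous.aestronglyMeasurable ?_) (ae_of_all _ fun v => ?_)
  · refine h.congr (ae_of_all _ fun v => ?_)
    simp only
    ring
  · refine (Continuous.const_cpow (by fun_prop) (Or.inl (by exact_mod_cast hx.ne'))).mul ?_
    rw [continuous_iff_continuousAt]
    intro v
    refine ContinuousAt.comp (f := fun v : ℝ => (α - (σ + v * Complex.I) : ℂ))
      (g := expMellin y W) ?_ (by fun_prop)
    exact (hW.differentiableAt_expMellin hy (by simpa using hσα)).continuousAt
  · rw [norm_mul, Complex.norm_cpow_eq_rpow_re_of_pos hx]
    have e : (-(σ + v * Complex.I : ℂ)).re = -σ := by simp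
    rw [e]
    have := hW.norm_expMellin_le y (α - (σ + v * Complex.I))
    have e2 : (α - (σ + v * Complex.I) : ℂ).re = α - σ := by simp
    rw [e2] at this
    gcongr

/-- Here `n - η` plays the role of `ν`. Writing `expMellin` as an integral over `u` and
interchanging leaves the Mellin-Barnes integral of a power at `z = x u`; each subtracted binomial
term becomes a value of `expMellin` at a shifted argument. -/
theorem integral_outer_vertical {η σ α x y : ℝ} {n : ℕ} {W : ℝ → ℝ} {C : ℝ}
    (hW : BoundedWeight W C) (hWx : BoundedWeight (fun u => W u * (1 + x * u) ^ (n - η)) C)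
    (hσ : 0 < σ) (hση : σ < η) (hη : η < 1) (hα : 1 ≤ α) (hx : 0 < x) (hy : 0 < y) :
    (∫ v : ℝ, Complex.Gamma (σ + v * Complex.I) *
      Complex.Gamma (-(n - η : ℝ) - (σ + v * Complex.I)) *
        (x : ℂ) ^ (-(σ + v * Complex.I : ℂ)) * expMellin y W (α - (σ + v * Complex.I))) =
      2 * Real.pi *
        (Real.Gamma (η - n) * expMellin y (fun u => W u * (1 + x * u) ^ (n - η)) α -
        ∑ k ∈ Finset.range n, (-1) ^ k / k.factorial * Real.Gamma (k + η - n) *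
          (x ^ (n - η - k) : ℝ) * expMellin y W ((α + (n - η) - k : ℝ))) := by
  set s : ℝ → ℂ := fun v => σ + v * Complex.I with hs
  set E : ℝ → ℝ := fun u => Real.exp (-(y * u)) * W u with hE
  set H : ℝ → ℂ := fun v => Complex.Gamma (s v) * Complex.Gamma ((η - n : ℝ) - s v) with hH
  set F : ℝ → ℝ → ℂ := fun u v => (u : ℂ) ^ (α - 1 : ℂ) * (E u : ℂ) *
    (H v * ((x * u : ℝ) : ℂ) ^ (-s v)) with hF
  have hHint : Integrable H := by
    refine Complex.integrable_Gamma_mul_Gamma_sub hσ _ fun k hk => ?_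
    rcases Nat.lt_or_ge k n with h | h
    · have : (k : ℝ) + 1 ≤ n := by exact_mod_cast h
      linarith
    · have : (n : ℝ) ≤ k := by exact_mod_cast h
      linarith
  have h1 : ∀ v : ℝ, Complex.Gamma (s v) * Complex.Gamma (-(n - η : ℝ) - s v) *
      (x : ℂ) ^ (-s v) * expMellin y W (α - s v) = ∫ u in Set.Ioi (0 : ℝ), F u v := by
    intro v
    rw [expMellin, mellin, ← integral_const_mul]
    refine setIntegral_congr_fun measurableSet_Ioi fun u hu => ?_
    rw [Set.mem_Ioi] at hu
    have hu0 : (u : ℂ) ≠ 0 := by exact_mod_cast hu.ne'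
    simp only [hF, hH, smul_eq_mul]
    rw [Complex.ofReal_mul x, Complex.mul_cpow_ofReal_nonneg hx.le hu.le]
    have : (u : ℂ) ^ (α - s v - 1) = (u : ℂ) ^ (α - 1 : ℂ) * (u : ℂ) ^ (-s v) := by
      rw [← Complex.cpow_add _ _ hu0]; ring_nf
    have e : (-(n - η : ℝ) : ℂ) - s v = (η - n : ℝ) - s v := by push_cast; ring
    rw [this, e]
    ring
  have hint : Integrable (Function.uncurry F)
      ((volume.restrict (Set.Ioi (0 : ℝ))).prod volume) := by
    have hg := hW.integrableOn hy (r := α - σ) (by linarith)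
    refine integrable_restrict_prod_of_norm_le measurableSet_Ioi (hg.const_mul (x ^ (-σ)))
      hHint.norm ?_ ?_
    · have hEm : AEStronglyMeasurable (fun u => (E u : ℂ)) (volume.restrict (Set.Ioi 0)) :=
        (hW.mellin_aux (y := y)).1.aestronglyMeasurable
      simp only [hF, Function.uncurry_def]
      refine AEStronglyMeasurable.mul (AEStronglyMeasurable.mul
        (Measurable.aestronglyMeasurable (by fun_prop)) hEm.comp_fst)
        (AEStronglyMeasurable.mul hHint.aestronglyMeasurable.comp_snd
          (Measurable.aestronglyMeasurable ?_))
      simp only [hs]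
      fun_prop
    · intro u hu v
      rw [Set.mem_Ioi] at hu
      simp only [hF, Function.uncurry_apply_pair, norm_mul]
      rw [Complex.norm_cpow_eq_rpow_re_of_pos hu,
        Complex.norm_cpow_eq_rpow_re_of_pos (mul_pos hx hu), Complex.norm_real,
        Real.norm_of_nonneg (mul_nonneg (Real.exp_pos _).le (hW.nonneg u hu))]
      have e1 : (-s v).re = -σ := by simp [hs]
      have e2 : α - σ - 1 = (α - 1 : ℂ).re + (-σ) := by simp; ring
      rw [e1, e2, Real.rpow_add hu, Real.mul_rpow hx.le hu.le]
      exact le_of_eq (by ring)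
  have h2 : ∀ u ∈ Set.Ioi (0 : ℝ), (∫ v : ℝ, F u v) =
      2 * Real.pi * ((Real.Gamma (η - n) *
          (u ^ (α - 1) * (Real.exp (-(y * u)) * (W u * (1 + x * u) ^ (n - η)))) -
        ∑ k ∈ Finset.range n, (-1) ^ k / k.factorial * Real.Gamma (k + η - n) *
          x ^ (n - η - k) *
            (u ^ (α + (n - η) - k - 1) * (Real.exp (-(y * u)) * W u)) : ℝ) : ℂ) := by
    intro u hu
    rw [Set.mem_Ioi] at hu
    simp only [hF]
    rw [integral_const_mul]
    simp only [hH, hs]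
    rw [integral_Gamma_mul_Gamma_mul_cpow_neg hσ hση hη n (mul_pos hx hu), mul_left_comm]
    congr 1
    have e : (u : ℂ) ^ (α - 1 : ℂ) = ((u ^ (α - 1) : ℝ) : ℂ) := by
      rw [Complex.ofReal_cpow hu.le]; push_cast; rfl
    rw [e, ← Complex.ofReal_mul, ← Complex.ofReal_mul]
    congr 1
    simp only [hE]
    rw [mul_sub, Finset.mul_sum]
    congr 1
    · ring
    · refine Finset.sum_congr rfl fun k _ => ?_
      rw [Real.mul_rpow hx.le hu.le]
      have : u ^ (α + (n - η) - k - 1) = u ^ (α - 1) * u ^ ((n - η) - k) := by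
        rw [← Real.rpow_add hu]; ring_nf
      rw [this]
      ring
  -- Since `k ≤ n - 1` and `η < 1`, the shifted arguments stay in the half plane of convergence.
  have hr : ∀ k ∈ Finset.range n, 0 < α + (n - η) - k := by
    intro k hk
    have : (k : ℝ) + 1 ≤ n := by exact_mod_cast Finset.mem_range.1 hk
    linarith
  refine (integral_congr_ae (ae_of_all _ h1)).trans ?_
  rw [← integral_integral_swap hint, setIntegral_congr_fun measurableSet_Ioi h2,
    integral_const_mul, integral_complex_ofReal, integral_sub, integral_const_mul,
    integral_finsetSum]
  · congr 1
    rw [Complex.ofReal_sub, Complex.ofReal_mul, expMellin_ofReal, Complex.ofReal_sum]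
    congr 1
    refine Finset.sum_congr rfl fun k _ => ?_
    rw [integral_const_mul, expMellin_ofReal]
    push_cast
    rfl
  · intro k hk
    exact (hW.integrableOn hy (hr k hk)).const_mul _
  · exact (hWx.integrableOn hy (r := α) (by linarith)).const_mul _
  · exact integrable_finsetSum _ fun k hk => (hW.integrableOn hy (hr k hk)).const_mul _

/-! ### Contours -/

/-- The infimum in `sepAbscissa` lies between `min (a + 2) b` and `b`, so its midpoint with `a` is
strictly between `a` and `b`; the cap `a + 2` can only move it left. -/
theorem sepAbscissa_mem_Ioo {A B : Set ℂ} {a b : ℝ} (hA : IsGreatest (Complex.re '' A) a)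
    (hab : a < b) (hb : ∃ q ∈ B, q.re = b) (hB : ∀ q ∈ B, a < q.re → b ≤ q.re) :
    sepAbscissa A B ∈ Set.Ioo a b := by
  obtain ⟨q, hq, hqb⟩ := hb
  have hlow : ∀ x ∈ insert (a + 2) {x | a < x ∧ ∃ q ∈ B, q.re = x}, min (a + 2) b ≤ x := by
    rintro x (rfl | ⟨hx, p, hp, rfl⟩)
    · exact min_le_left _ _
    · exact (min_le_right _ _).trans (hB p hp hx)
  have h1 : min (a + 2) b ≤ sInf (insert (a + 2) {x | a < x ∧ ∃ q ∈ B, q.re = x}) :=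
    le_csInf ⟨_, Set.mem_insert _ _⟩ hlow
  have h2 : sInf (insert (a + 2) {x | a < x ∧ ∃ q ∈ B, q.re = x}) ≤ b :=
    csInf_le ⟨_, hlow⟩ (Set.mem_insert_of_mem _ ⟨hab, q, hq, hqb⟩)
  have h3 : a < min (a + 2) b := lt_min (by linarith) hab
  rw [sepAbscissa, hA.csSup_eq]
  constructor <;> linarith

/-- Ensures that a closed disc of this radius around one pole contains no other pole, provided the
radius is positive. -/
theorem two_mul_sepRadius_le_dist {A B : Set ℂ} {p q : ℂ} (hp : p ∈ A ∪ B) (hq : q ∈ A ∪ B)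
    (hpq : p ≠ q) : 2 * sepRadius A B ≤ dist p q := by
  rw [sepRadius, mul_div_cancel₀ _ two_ne_zero]
  refine csInf_le ⟨0, ?_⟩ (Set.mem_insert_of_mem _ ⟨p, hp, q, hq, hpq, rfl⟩)
  rintro x (rfl | ⟨p, -, q, -, -, rfl⟩)
  · exact zero_le_one
  · exact dist_nonneg

theorem sepRadius_le (A B : Set ℂ) : sepRadius A B ≤ 1 / 2 := by
  rw [sepRadius]
  refine div_le_div_of_nonneg_right (csInf_le ⟨0, ?_⟩ (Set.mem_insert _ _)) zero_le_two
  rintro x (rfl | ⟨p, -, q, -, -, rfl⟩)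
  · exact zero_le_one
  · exact dist_nonneg

/-- The pole families are infinite, so a uniform gap `d` is needed to keep the infimum away from
`0`. -/
theorem sepRadius_pos {A B : Set ℂ} {d : ℝ} (hd : 0 < d)
    (h : ∀ p ∈ A ∪ B, ∀ q ∈ A ∪ B, p ≠ q → d ≤ dist p q) : 0 < sepRadius A B := by
  rw [sepRadius]
  refine half_pos (lt_of_lt_of_le (lt_min zero_lt_one hd) (le_csInf ⟨_, Set.mem_insert _ _⟩ ?_))
  rintro x (rfl | ⟨p, hp, q, hq, hpq, rfl⟩)
  · exact min_le_left _ _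
  · exact (min_le_right _ _).trans (h p hp q hq hpq)

theorem mellinBarnes_of_misplaced_eq_empty {A B : Set ℂ} (h : misplaced A B = ∅) (f : ℂ → ℂ) :
    mellinBarnes A B f =
      (2 * Real.pi : ℂ)⁻¹ * ∫ v : ℝ, f (sepAbscissa A B + v * Complex.I) := by
  rw [mellinBarnes, h]
  simp only [Set.mem_empty_iff_false, finsum_false, finsum_zero, sub_zero]
  have := Complex.I_ne_zero
  field_simp

/-! ### The kernels and pole families of the function in the closed form -/

theorem t6Block₁_kernel (ν : ℝ) (α : ℕ) (u : ℂ) :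
    (t6Block₁ ν α).kernel u = Complex.Gamma (ν - α + u) * Complex.Gamma (α - u) := by
  simp [GammaBlock.kernel, t6Block₁]

theorem t6Block₂_kernel (ν : ℝ) (u : ℂ) :
    (t6Block₂ ν).kernel u = Complex.Gamma u * Complex.Gamma (-ν - u) := by
  simp [GammaBlock.kernel, t6Block₂]

theorem t6Block₃_kernel (u : ℂ) : t6Block₃.kernel u = Complex.Gamma u := by
  simp [GammaBlock.kernel, t6Block₃]

theorem mem_t6_innerLeft {ν : ℝ} {α : ℕ} {s p : ℂ} :
    p ∈ egbInnerLeft (t6Block₁ ν α) t6Block₃ s ↔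
      (∃ k : ℕ, p = α - ν - s - k) ∨ ∃ k : ℕ, p = -k := by
  simp [egbInnerLeft, leftPoles, t6Block₁, t6Block₃]

theorem mem_t6_innerRight {ν : ℝ} {α : ℕ} {s p : ℂ} :
    p ∈ egbInnerRight (t6Block₁ ν α) t6Block₃ s ↔ ∃ k : ℕ, p = α - s + k := by
  simp [egbInnerRight, rightPoles, t6Block₁, t6Block₃]

theorem mem_t6_outerLeft {ν : ℝ} {α : ℕ} {p : ℂ} :
    p ∈ egbOuterLeft (t6Block₁ ν α) (t6Block₂ ν) t6Block₃ ↔ ∃ k : ℕ, p = -k := by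
  simp [egbOuterLeft, leftPoles, t6Block₁, t6Block₂, t6Block₃]

theorem mem_t6_outerRight {ν : ℝ} {α : ℕ} {p : ℂ} :
    p ∈ egbOuterRight (t6Block₁ ν α) (t6Block₂ ν) t6Block₃ ↔
      (∃ k : ℕ, p = -ν + k) ∨ ∃ k : ℕ, p = α + k := by
  simp [egbOuterRight, rightPoles, t6Block₁, t6Block₂, t6Block₃]

/-! ### The inner integral -/

/-- For `Re s < α` and `ν > 0` both left sequences end strictly before the first right pole `α - s`,
so a straight line separates them and no circles occur. -/
theorem t6_inner_sepAbscissa {ν : ℝ} (hν : 0 < ν) {α : ℕ} {s : ℂ} (hs : s.re < α) :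
    sepAbscissa (egbInnerLeft (t6Block₁ ν α) t6Block₃ s)
      (egbInnerRight (t6Block₁ ν α) t6Block₃ s) ∈
        Set.Ioo (max (α - ν - s.re) 0) (α - s.re) := by
  refine sepAbscissa_mem_Ioo ⟨?_, ?_⟩ (max_lt (by linarith) (by linarith))
    ⟨α - s, mem_t6_innerRight.2 ⟨0, by simp⟩, by simp⟩ ?_
  · rcases max_choice (α - ν - s.re) 0 with h | h <;> rw [h]
    · exact ⟨α - ν - s, mem_t6_innerLeft.2 (Or.inl ⟨0, by simp⟩), by simp⟩
    · exact ⟨0, mem_t6_innerLeft.2 (Or.inr ⟨0, by simp⟩), by simp⟩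
  · rintro _ ⟨p, hp, rfl⟩
    rcases mem_t6_innerLeft.1 hp with ⟨k, rfl⟩ | ⟨k, rfl⟩
    · exact le_max_of_le_left (by simp)
    · exact le_max_of_le_right (by simp)
  · intro q hq _
    obtain ⟨k, rfl⟩ := mem_t6_innerRight.1 hq
    simp

theorem t6_inner_misplaced {ν : ℝ} (hν : 0 < ν) {α : ℕ} {s : ℂ} (hs : s.re < α) :
    misplaced (egbInnerLeft (t6Block₁ ν α) t6Block₃ s)
      (egbInnerRight (t6Block₁ ν α) t6Block₃ s) = ∅ := by
  refine Set.eq_empty_of_forall_notMem fun p hp => ?_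
  obtain ⟨k, rfl⟩ := mem_t6_innerRight.1 hp.1
  have h1 := hp.2
  have h2 := (t6_inner_sepAbscissa hν hs).2
  have h3 : (0 : ℝ) ≤ k := k.cast_nonneg
  simp at h1
  linarith

theorem t6_innerIntegrand (ν y : ℝ) (α : ℕ) (s t : ℂ) :
    egbInnerIntegrand (t6Block₁ ν α) t6Block₃ y s t =
      Complex.Gamma (ν - (α - s) + t) * Complex.Gamma ((α - s) - t) * Complex.Gamma t *
        (y : ℂ) ^ (-t) := by
  rw [egbInnerIntegrand, t6Block₁_kernel, t6Block₃_kernel]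
  ring_nf

theorem t6_inner_converges {ν y : ℝ} (hν : 0 < ν) (hy : 0 < y) {α : ℕ} {s : ℂ} (hs : s.re < α) :
    MellinBarnesConverges (egbInnerLeft (t6Block₁ ν α) t6Block₃ s)
      (egbInnerRight (t6Block₁ ν α) t6Block₃ s) (egbInnerIntegrand (t6Block₁ ν α) t6Block₃ y s) := by
  refine ⟨?_, ?_, ?_⟩
  · rw [Set.disjoint_left]
    intro p hp hq
    obtain ⟨j, rfl⟩ := mem_t6_innerRight.1 hq
    have hj : (0 : ℝ) ≤ j := j.cast_nonneg
    rcases mem_t6_innerLeft.1 hp with ⟨k, h⟩ | ⟨k, h⟩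
    all_goals
      have hk : (0 : ℝ) ≤ k := k.cast_nonneg
      have := congrArg Complex.re h
      simp at this
      linarith
  · obtain ⟨h1, h2⟩ := t6_inner_sepAbscissa hν hs
    obtain ⟨h3, h4⟩ := max_lt_iff.1 h1
    simp only [t6_innerIntegrand]
    exact integrable_inner_vertical h4 (by simpa using h2) (by simp; linarith) hy
  · rw [t6_inner_misplaced hν hs]
    simp

theorem t6_inner_eq {ν y : ℝ} (hν : 0 < ν) (hy : 0 < y) {α : ℕ} {s : ℂ} (hs : s.re < α) :
    mellinBarnes (egbInnerLeft (t6Block₁ ν α) t6Block₃ s)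
      (egbInnerRight (t6Block₁ ν α) t6Block₃ s) (egbInnerIntegrand (t6Block₁ ν α) t6Block₃ y s) =
      Complex.Gamma ν * expMellin y (fun u => (1 + u) ^ (-ν)) (α - s) := by
  obtain ⟨h1, h2⟩ := t6_inner_sepAbscissa hν hs
  obtain ⟨h3, h4⟩ := max_lt_iff.1 h1
  rw [mellinBarnes_of_misplaced_eq_empty (t6_inner_misplaced hν hs)]
  simp only [t6_innerIntegrand]
  rw [integral_inner_vertical h4 (by simpa using h2) (by simp; linarith) hy,
    inv_mul_cancel_left₀ (by simp [Real.pi_ne_zero])]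

theorem t6_outerIntegrand {ν x y : ℝ} (hν : 0 < ν) (hy : 0 < y) {α : ℕ} {s : ℂ}
    (hs : s.re < α) :
    egbOuterIntegrand (t6Block₁ ν α) (t6Block₂ ν) t6Block₃ x y s =
      Complex.Gamma ν * (Complex.Gamma s * Complex.Gamma (-ν - s) * (x : ℂ) ^ (-s) *
        expMellin y (fun u => (1 + u) ^ (-ν)) (α - s)) := by
  rw [egbOuterIntegrand, t6_inner_eq hν hy hs, t6Block₂_kernel]
  ring

/-! ### Residues -/

theorem Complex.Gamma_add_natCast (w : ℂ) (k : ℕ) (hw : ∀ j < k, w + j ≠ 0) :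
    Complex.Gamma (w + k) = (∏ j ∈ Finset.range k, (w + j)) * Complex.Gamma w := by
  induction k with
  | zero => simp
  | succ k ih =>
    rw [Finset.prod_range_succ, Nat.cast_succ, ← add_assoc,
      Complex.Gamma_add_one _ (hw k k.lt_succ_self), ih fun j hj => hw j (hj.trans k.lt_succ_self)]
    ring

theorem prod_range_neg_add (k : ℕ) :
    ∏ j ∈ Finset.range k, (-(k : ℂ) + j) = (-1) ^ k * k.factorial := by
  rw [← Finset.prod_range_reflect, ← Finset.prod_range_add_one_eq_factorial, Nat.cast_prod,
    ← Finset.card_range k, ← Finset.prod_const, Finset.card_range, ← Finset.prod_mul_distrib]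
  refine Finset.prod_congr rfl fun j hj => ?_
  have := Finset.mem_range.1 hj
  rw [Nat.sub_sub, Nat.cast_sub (by omega)]
  push_cast
  ring

/-- The integral of `Γ(a - s) φ(s)` around the pole `a + k` of `Γ(a - s)`. -/
theorem circleIntegral_Gamma_sub_mul {a : ℂ} {k : ℕ} {r : ℝ} (hr : 0 < r) (hr1 : r < 1)
    {φ : ℂ → ℂ} (hφ : DifferentiableOn ℂ φ (Metric.closedBall (a + k) r)) :
    ContinuousOn (fun s => Complex.Gamma (a - s) * φ s) (Metric.sphere (a + k) r) ∧
    circleIntegral (fun s => Complex.Gamma (a - s) * φ s) (a + k) r =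
      -(2 * Real.pi * Complex.I) * ((-1) ^ k / k.factorial * φ (a + k)) := by
  set p : ℂ := a + k with hp
  have hint : ∀ s ∈ Metric.closedBall p r, ∀ m : ℤ, s = p + m → m = 0 := by
    intro s hs m h
    rw [Metric.mem_closedBall, h, dist_eq_norm, add_sub_cancel_left, Complex.norm_intCast] at hs
    have : |(m : ℝ)| < 1 := hs.trans_lt hr1
    rw [← Int.cast_abs] at this
    have h2 : |m| < 1 := by exact_mod_cast this
    exact Int.abs_lt_one_iff.1 h2
  have hj : ∀ s ∈ Metric.closedBall p r, ∀ j : ℕ, a - s + j = 0 → j = k := by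
    intro s hs j h
    have := hint s hs (j - k) (by rw [hp]; push_cast; linear_combination -h)
    omega
  -- The recurrence gives `Γ(a - s) = Γ(a - s + k + 1) / ∏_{j ≤ k} (a - s + j)`. The factor `j = k`
  -- is `-(s - p)`, whence the sign; as `r < 1`, the other factors do not vanish on the disc. Thus
  -- `g` is holomorphic there and Cauchy's formula applies.
  set g : ℂ → ℂ := fun s => -(Complex.Gamma (a - s + (k + 1 : ℕ)) /
    (∏ j ∈ Finset.range k, (a - s + j)) * φ s) with hg
  have hgd : DifferentiableOn ℂ g (Metric.closedBall p r) := by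
    refine DifferentiableOn.neg (DifferentiableOn.mul (DifferentiableOn.div ?_ ?_ ?_) hφ)
    · intro s hs
      refine DifferentiableAt.differentiableWithinAt ?_
      refine DifferentiableAt.comp (f := fun s => a - s + (k + 1 : ℕ)) (g := Complex.Gamma) s
        (Complex.differentiableAt_Gamma _ fun m hm => ?_) (by fun_prop)
      have := hint s hs (m + 1) (by
        rw [hp]; push_cast at hm ⊢; linear_combination -hm)
      omega
    · fun_prop
    · intro s hs
      rw [Finset.prod_ne_zero_iff]
      intro j hjk h
      have h1 := hj s hs j h
      have h2 := Finset.mem_range.1 hjk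
      omega
  have heq : Set.EqOn (fun s => Complex.Gamma (a - s) * φ s) (fun s => (s - p)⁻¹ • g s)
      (Metric.sphere p r) := by
    intro s hs
    have hsp : s ≠ p := Metric.ne_of_mem_sphere hs hr.ne'
    have hsub : s - p ≠ 0 := sub_ne_zero.2 hsp
    have hsb : s ∈ Metric.closedBall p r := Metric.sphere_subset_closedBall hs
    have hprod : ∏ j ∈ Finset.range k, (a - s + j) ≠ 0 := by
      rw [Finset.prod_ne_zero_iff]
      intro j hjk h
      have h1 := hj s hsb j h
      have h2 := Finset.mem_range.1 hjk
      omega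
    have hΓ : Complex.Gamma (a - s + (k + 1 : ℕ)) =
        (∏ j ∈ Finset.range k, (a - s + j)) * (-(s - p)) * Complex.Gamma (a - s) := by
      rw [Complex.Gamma_add_natCast, Finset.prod_range_succ]
      · rw [hp]; ring_nf
      · intro j _ h
        have h1 := hj s hsb j h
        apply hsub
        rw [hp, ← h1]
        linear_combination -h
    simp only [hg, smul_eq_mul]
    rw [hΓ]
    field_simp
  constructor
  · refine ContinuousOn.congr (ContinuousOn.smul (ContinuousOn.inv₀
      (f := fun s => s - p) (by fun_prop) ?_)
      (hgd.continuousOn.mono Metric.sphere_subset_closedBall)) heq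
    intro s hs
    exact sub_ne_zero.2 (Metric.ne_of_mem_sphere hs hr.ne')
  · rw [circleIntegral.integral_congr hr.le heq,
      hgd.circleIntegral_sub_inv_smul (Metric.mem_ball_self hr)]
    simp only [hg, smul_eq_mul]
    have e1 : a - p = -k := by rw [hp]; ring
    have e2 : Complex.Gamma (a - p + (k + 1 : ℕ)) = 1 := by
      rw [e1]; push_cast; simp
    rw [e2, e1, prod_range_neg_add]
    have : ((-1 : ℂ) ^ k) * (-1) ^ k = 1 := by rw [← mul_pow]; simp
    have h0 : ((-1 : ℂ) ^ k) ≠ 0 := by simp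
    have hf : (k.factorial : ℂ) ≠ 0 := by exact_mod_cast k.factorial_ne_zero
    field_simp
    linear_combination (φ p) * this

/-! ### The outer integral -/

/-- The rightmost left pole is `0`. The first right pole with positive real part is `-ν + ⌊ν⌋ + 1`,
which does not exceed `1 ≤ α`. -/
theorem t6_outer_sepAbscissa {ν : ℝ} (hν : 0 < ν) {α : ℕ} (hα : 1 ≤ α) :
    sepAbscissa (egbOuterLeft (t6Block₁ ν α) (t6Block₂ ν) t6Block₃)
      (egbOuterRight (t6Block₁ ν α) (t6Block₂ ν) t6Block₃) ∈
        Set.Ioo 0 ((⌊ν⌋₊ + 1 : ℕ) - ν) := by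
  have h1 := Nat.lt_floor_add_one ν
  have h2 := Nat.floor_le hν.le
  have hα' : (1 : ℝ) ≤ α := by exact_mod_cast hα
  refine sepAbscissa_mem_Ioo ⟨⟨0, mem_t6_outerLeft.2 ⟨0, by simp⟩, by simp⟩, ?_⟩
    (by push_cast; linarith)
    ⟨-ν + (⌊ν⌋₊ + 1 : ℕ), mem_t6_outerRight.2 (Or.inl ⟨_, rfl⟩), by simp; ring⟩ ?_
  · rintro _ ⟨p, hp, rfl⟩
    obtain ⟨k, rfl⟩ := mem_t6_outerLeft.1 hp
    simp
  · intro q hq hq0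
    rcases mem_t6_outerRight.1 hq with ⟨k, rfl⟩ | ⟨k, rfl⟩
    · simp at hq0 ⊢
      have h3 : ⌊ν⌋₊ < k := (Nat.floor_lt hν.le).2 (by linarith)
      have h4 : ((⌊ν⌋₊ : ℝ)) + 1 ≤ k := by exact_mod_cast h3
      linarith
    · have h3 : (0 : ℝ) ≤ k := k.cast_nonneg
      simp at hq0 ⊢
      linarith

theorem t6_outer_misplaced {ν : ℝ} (hν : 0 < ν) {α : ℕ} (hα : 1 ≤ α) :
    misplaced (egbOuterLeft (t6Block₁ ν α) (t6Block₂ ν) t6Block₃)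
      (egbOuterRight (t6Block₁ ν α) (t6Block₂ ν) t6Block₃) =
      ((Finset.range (⌊ν⌋₊ + 1)).image fun k : ℕ => (-ν + k : ℂ) : Finset ℂ) := by
  have h1 := Nat.lt_floor_add_one ν
  have h2 := Nat.floor_le hν.le
  have hα' : (1 : ℝ) ≤ α := by exact_mod_cast hα
  obtain ⟨h3, h4⟩ := t6_outer_sepAbscissa hν hα
  push_cast at h4
  ext p
  simp only [Finset.coe_image, Finset.coe_range, Set.mem_image, Set.mem_Iio]
  constructor
  · rintro ⟨hp, hlt⟩
    rcases mem_t6_outerRight.1 hp with ⟨k, rfl⟩ | ⟨k, rfl⟩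
    · refine ⟨k, ?_, rfl⟩
      simp at hlt
      have : (k : ℝ) < (⌊ν⌋₊ + 1 : ℕ) := by push_cast; linarith
      exact_mod_cast this
    · have : (0 : ℝ) ≤ k := k.cast_nonneg
      simp at hlt
      linarith
  · rintro ⟨k, hk, rfl⟩
    refine ⟨mem_t6_outerRight.2 (Or.inl ⟨k, rfl⟩), ?_⟩
    have : (k : ℝ) ≤ ⌊ν⌋₊ := by exact_mod_cast Nat.lt_succ_iff.1 hk
    simp
    linarith

theorem t6_outer_poles {ν : ℝ} {α : ℕ} {p : ℂ}
    (hp : p ∈ egbOuterLeft (t6Block₁ ν α) (t6Block₂ ν) t6Block₃ ∪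
      egbOuterRight (t6Block₁ ν α) (t6Block₂ ν) t6Block₃) :
    (∃ z : ℤ, p = z) ∨ ∃ z : ℤ, p = -ν + z := by
  rcases hp with hp | hp
  · obtain ⟨k, rfl⟩ := mem_t6_outerLeft.1 hp
    exact Or.inl ⟨-k, by simp⟩
  · rcases mem_t6_outerRight.1 hp with ⟨k, rfl⟩ | ⟨k, rfl⟩
    · exact Or.inr ⟨k, by simp⟩
    · exact Or.inl ⟨α + k, by simp⟩

/-- All poles lie in `ℤ` or in `-ν + ℤ`. Distinct points of one class are at distance at least `1`,
points of different classes at least the distance from `ν` to the nearest integer. -/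
theorem t6_outer_sepRadius_pos {ν : ℝ} (hν : 0 < ν) (hνk : ∀ k : ℕ, ν ≠ k) (α : ℕ) :
    0 < sepRadius (egbOuterLeft (t6Block₁ ν α) (t6Block₂ ν) t6Block₃)
      (egbOuterRight (t6Block₁ ν α) (t6Block₂ ν) t6Block₃) := by
  have hνz : ∀ z : ℤ, ν ≠ z := by
    intro z hz
    have h0 : (0 : ℝ) < z := hz ▸ hν
    have h1 : 0 < z := by exact_mod_cast h0
    apply hνk z.toNat
    rw [hz]
    exact_mod_cast (Int.toNat_of_nonneg h1.le).symm
  have hd1 : |ν - round ν| ≤ 1 := (abs_sub_round ν).trans (by norm_num)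
  have hint : ∀ z w : ℤ, z ≠ w → (1 : ℝ) ≤ dist (z : ℂ) w := by
    intro z w h
    rw [dist_eq_norm, ← Int.cast_sub, Complex.norm_intCast]
    exact_mod_cast Int.one_le_abs (sub_ne_zero.2 h)
  have hmix : ∀ z w : ℤ, |ν - round ν| ≤ dist (z : ℂ) (-ν + w) := by
    intro z w
    have e : (z : ℂ) - (-ν + w) = ((ν - (w - z : ℤ) : ℝ) : ℂ) := by push_cast; ring
    rw [dist_eq_norm, e, Complex.norm_real]
    exact round_le ν _
  refine sepRadius_pos (d := |ν - round ν|) (abs_pos.2 (sub_ne_zero.2 (hνz _))) ?_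
  intro p hp q hq hpq
  rcases t6_outer_poles hp with ⟨z, rfl⟩ | ⟨z, rfl⟩ <;>
    rcases t6_outer_poles hq with ⟨w, rfl⟩ | ⟨w, rfl⟩
  · exact hd1.trans (hint z w fun h => hpq (by rw [h]))
  · exact hmix z w
  · rw [dist_comm]; exact hmix w z
  · rw [dist_add_left]
    exact hd1.trans (hint z w fun h => hpq (by rw [h]))

/-- The centres have real part at most `0` and the radius is at most `1/2`, so the evaluation of the
inner integral, valid for `Re s < α`, holds on the circles. -/
theorem t6_outer_circle_re_lt {ν : ℝ} (hν : 0 < ν) {α : ℕ} (hα : 1 ≤ α)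
    {k : ℕ} (hk : k < ⌊ν⌋₊ + 1) {s : ℂ}
    (hs : s ∈ Metric.closedBall (-ν + k : ℂ)
      (sepRadius (egbOuterLeft (t6Block₁ ν α) (t6Block₂ ν) t6Block₃)
      (egbOuterRight (t6Block₁ ν α) (t6Block₂ ν) t6Block₃))) : s.re < α := by
  have hα' : (1 : ℝ) ≤ α := by exact_mod_cast hα
  have h2 := Nat.floor_le hν.le
  have hk' : (k : ℝ) ≤ ⌊ν⌋₊ := by exact_mod_cast Nat.lt_succ_iff.1 hk
  rw [Metric.mem_closedBall, dist_eq_norm] at hs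
  have h1 := (Complex.re_le_norm _).trans (hs.trans (sepRadius_le _ _))
  simp at h1
  linarith

theorem t6_outer_circle {ν x y : ℝ} (hν : 0 < ν) (hνk : ∀ k : ℕ, ν ≠ k) {α : ℕ} (hα : 1 ≤ α)
    (hx : 0 < x) (hy : 0 < y) {k : ℕ} (hk : k < ⌊ν⌋₊ + 1) :
    CircleIntegrable (egbOuterIntegrand (t6Block₁ ν α) (t6Block₂ ν) t6Block₃ x y) (-ν + k)
      (sepRadius (egbOuterLeft (t6Block₁ ν α) (t6Block₂ ν) t6Block₃)
      (egbOuterRight (t6Block₁ ν α) (t6Block₂ ν) t6Block₃)) ∧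
    circleIntegral (egbOuterIntegrand (t6Block₁ ν α) (t6Block₂ ν) t6Block₃ x y) (-ν + k)
      (sepRadius (egbOuterLeft (t6Block₁ ν α) (t6Block₂ ν) t6Block₃)
      (egbOuterRight (t6Block₁ ν α) (t6Block₂ ν) t6Block₃)) =
      -(2 * Real.pi * Complex.I) * (Complex.Gamma ν * ((-1) ^ k / k.factorial *
        Real.Gamma (k - ν) * (x ^ (ν - k) : ℝ) *
          expMellin y (fun u => (1 + u) ^ (-ν)) ((α + ν - k : ℝ)))) := by
  have hr := t6_outer_sepRadius_pos hν hνk α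
  have hre := fun {s} => t6_outer_circle_re_lt hν hα hk (s := s)
  set r := sepRadius (egbOuterLeft (t6Block₁ ν α) (t6Block₂ ν) t6Block₃)
      (egbOuterRight (t6Block₁ ν α) (t6Block₂ ν) t6Block₃) with hrdef
  have hr1 : r < 1 := (sepRadius_le _ _).trans_lt (by norm_num)
  set φ : ℂ → ℂ := fun s => Complex.Gamma ν * (Complex.Gamma s * (x : ℂ) ^ (-s) *
    expMellin y (fun u => (1 + u) ^ (-ν)) (α - s)) with hφ
  have heq : ∀ s ∈ Metric.closedBall (-ν + k : ℂ) r,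
      egbOuterIntegrand (t6Block₁ ν α) (t6Block₂ ν) t6Block₃ x y s =
        Complex.Gamma (-ν - s) * φ s := by
    intro s hs
    rw [t6_outerIntegrand hν hy (hre hs)]
    simp only [hφ]
    ring
  have hφd : DifferentiableOn ℂ φ (Metric.closedBall (-ν + k : ℂ) r) := by
    intro s hs
    refine DifferentiableAt.differentiableWithinAt ?_
    refine DifferentiableAt.const_mul (DifferentiableAt.mul (DifferentiableAt.mul ?_ ?_) ?_) _
    · refine Complex.differentiableAt_Gamma _ fun m hm => ?_
      -- A pole `-m` of `Γ(s)` in the disc would be within `r` of the centre, against the mutual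
      -- distance of at least `2r`.
      have hd := two_mul_sepRadius_le_dist
        (A := egbOuterLeft (t6Block₁ ν α) (t6Block₂ ν) t6Block₃)
        (B := egbOuterRight (t6Block₁ ν α) (t6Block₂ ν) t6Block₃)
        (Or.inl (mem_t6_outerLeft.2 ⟨m, hm⟩))
        (Or.inr (mem_t6_outerRight.2 (Or.inl ⟨k, rfl⟩))) (fun h => by
          have h1 := congrArg Complex.re (hm.symm.trans h)
          simp at h1
          exact hνk (m + k) (by push_cast; linarith))
      rw [← hrdef] at hd
      rw [Metric.mem_closedBall] at hs
      linarith
    · exact DifferentiableAt.const_cpow (by fun_prop) (Or.inl (by exact_mod_cast hx.ne'))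
    · refine DifferentiableAt.comp (f := fun s : ℂ => (α - s : ℂ))
        (g := expMellin y fun u => (1 + u) ^ (-ν)) s ?_ (by fun_prop)
      exact (boundedWeight_one_add_rpow_neg hν.le).differentiableAt_expMellin hy
        (by simpa using hre hs)
  obtain ⟨hc, hi⟩ := circleIntegral_Gamma_sub_mul hr hr1 hφd
  constructor
  · refine ContinuousOn.circleIntegrable hr.le (hc.congr fun s hs => ?_)
    exact heq s (Metric.sphere_subset_closedBall hs)
  · rw [circleIntegral.integral_congr hr.le
      (fun s hs => heq s (Metric.sphere_subset_closedBall hs)), hi]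
    simp only [hφ]
    have e1 : Complex.Gamma (-ν + k) = ((Real.Gamma (k - ν) : ℝ) : ℂ) := by
      rw [← Complex.Gamma_ofReal]; push_cast; ring_nf
    have e2 : (x : ℂ) ^ (-(-ν + k : ℂ)) = ((x ^ (ν - k) : ℝ) : ℂ) := by
      rw [Complex.ofReal_cpow hx.le]; push_cast; ring_nf
    have e3 : (α - (-ν + k) : ℂ) = ((α + ν - k : ℝ) : ℂ) := by push_cast; ring
    rw [e1, e2, e3]
    ring

theorem t6_neg_sub_ne {ν σ : ℝ} (hν : 0 < ν) (h : σ ∈ Set.Ioo 0 ((⌊ν⌋₊ + 1 : ℕ) - ν)) (k : ℕ) :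
    -ν - σ ≠ -k := by
  intro hk
  have h2 := Nat.floor_le hν.le
  obtain ⟨h3, h4⟩ := h
  push_cast at h4
  have h5 : (k : ℝ) < (⌊ν⌋₊ + 1 : ℕ) := by push_cast; linarith
  have h6 : k ≤ ⌊ν⌋₊ := Nat.lt_succ_iff.1 (by exact_mod_cast h5)
  have h7 : (k : ℝ) ≤ ⌊ν⌋₊ := by exact_mod_cast h6
  linarith

theorem t6_outer_line_re_lt {ν : ℝ} (hν : 0 < ν) (hνk : ∀ k : ℕ, ν ≠ k) {α : ℕ} (hα : 1 ≤ α) :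
    sepAbscissa (egbOuterLeft (t6Block₁ ν α) (t6Block₂ ν) t6Block₃)
      (egbOuterRight (t6Block₁ ν α) (t6Block₂ ν) t6Block₃) < α := by
  have h := (t6_outer_sepAbscissa hν hα).2
  have h2 : (⌊ν⌋₊ : ℝ) < ν :=
    lt_of_le_of_ne (Nat.floor_le hν.le) (fun h => hνk _ h.symm)
  have hα' : (1 : ℝ) ≤ α := by exact_mod_cast hα
  push_cast at h
  linarith

theorem t6_converges {ν x y : ℝ} (hν : 0 < ν) (hνk : ∀ k : ℕ, ν ≠ k) {α : ℕ} (hα : 1 ≤ α)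
    (hx : 0 < x) (hy : 0 < y) :
    EGBMeijerGConverges (t6Block₁ ν α) (t6Block₂ ν) t6Block₃ x y := by
  have hσ := t6_outer_sepAbscissa hν hα
  have hlt := t6_outer_line_re_lt hν hνk hα
  refine ⟨⟨?_, ?_, ?_⟩, ?_⟩
  · rw [Set.disjoint_left]
    intro p hp hq
    obtain ⟨j, rfl⟩ := mem_t6_outerLeft.1 hp
    rcases mem_t6_outerRight.1 hq with ⟨k, h⟩ | ⟨k, h⟩
    · have h1 := congrArg Complex.re h
      simp at h1
      exact hνk (j + k) (by push_cast; linarith)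
    · have h1 := congrArg Complex.re h
      have hα' : (1 : ℝ) ≤ α := by exact_mod_cast hα
      have hj : (0 : ℝ) ≤ j := j.cast_nonneg
      have hk : (0 : ℝ) ≤ k := k.cast_nonneg
      simp at h1
      linarith
  · have h := (integrable_outer_vertical (α := α) (boundedWeight_one_add_rpow_neg hν.le) hσ.1 hlt
      (t6_neg_sub_ne hν hσ) hx hy).const_mul (Complex.Gamma ν)
    refine h.congr (ae_of_all _ fun v => ?_)
    beta_reduce
    rw [t6_outerIntegrand hν hy (by simpa using hlt)]
    push_cast
    rfl
  · intro p hp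
    rw [t6_outer_misplaced hν hα, Finset.mem_coe, Finset.mem_image] at hp
    obtain ⟨k, hk, rfl⟩ := hp
    exact (t6_outer_circle hν hνk hα hx hy (Finset.mem_range.1 hk)).1
  · intro s hs
    refine t6_inner_converges hν hy ?_
    rcases hs with hs | hs
    · rw [Set.mem_ofPred_eq] at hs
      rw [hs]
      exact hlt
    · rw [t6_outer_misplaced hν hα] at hs
      simp only [Set.mem_iUnion, Finset.mem_coe, Finset.mem_image] at hs
      obtain ⟨p, ⟨k, hk, rfl⟩, hs⟩ := hs
      exact t6_outer_circle_re_lt hν hα (Finset.mem_range.1 hk)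
        (Metric.sphere_subset_closedBall hs)

/-- The Meijer G-function of the closed form is a Laplace-type integral. -/
theorem egbMeijerG_t6 {ν x y : ℝ} (hν : 0 < ν) (hνk : ∀ k : ℕ, ν ≠ k) {α : ℕ} (hα : 1 ≤ α)
    (hx : 0 < x) (hy : 0 < y) :
    egbMeijerG (t6Block₁ ν α) (t6Block₂ ν) t6Block₃ x y =
      ((Real.Gamma ν * Real.Gamma (-ν) * ∫ u in Set.Ioi (0 : ℝ), u ^ ((α : ℝ) - 1) *
        (Real.exp (-(y * u)) * ((1 + u) ^ (-ν) * (1 + x * u) ^ ν)) : ℝ) : ℂ) := by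
  have hσ := t6_outer_sepAbscissa hν hα
  have hlt := t6_outer_line_re_lt hν hνk hα
  -- With `η = n - ν`, which is below `1` as `ν` is not an integer, the number `n` counts both the
  -- misplaced poles and the subtracted binomial terms.
  set n := ⌊ν⌋₊ + 1 with hn
  set η : ℝ := n - ν with hη
  have hνη : ν = n - η := by rw [hη]; ring
  have hηn : η - n = -ν := by rw [hη]; ring
  have hη1 : η < 1 := by
    have h2 : (⌊ν⌋₊ : ℝ) < ν :=
      lt_of_le_of_ne (Nat.floor_le hν.le) (fun h => hνk _ h.symm)
    rw [hη, hn]; push_cast; linarith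
  have hα' : (1 : ℝ) ≤ α := by exact_mod_cast hα
  have hline := integral_outer_vertical (η := η) (n := n) (α := α) (x := x) (y := y)
    (W := fun u => (1 + u) ^ (-ν)) (C := max 1 ((1 + x) ^ ν))
    (by
      have := boundedWeight_one_add_rpow_neg hν.le
      exact ⟨this.1, this.2, fun u hu => (this.3 u hu).trans (le_max_left _ _)⟩)
    (by
      rw [← hνη]
      have := boundedWeight_one_add_mul_rpow hν.le hx
      exact ⟨this.1, this.2, fun u hu => (this.3 u hu).trans (le_max_right _ _)⟩)
    hσ.1 hσ.2 hη1 hα' hx hy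
  simp_rw [add_sub_assoc, hηn] at hline
  rw [← hνη] at hline
  rw [egbMeijerG, mellinBarnes, t6_outer_misplaced hν hα, finsum_mem_coe_finset,
    Finset.sum_image (by
      intro i _ j _ h
      exact_mod_cast add_left_cancel h),
    Finset.sum_congr rfl fun k hk =>
      (t6_outer_circle hν hνk hα hx hy (Finset.mem_range.1 hk)).2]
  set σ := sepAbscissa (egbOuterLeft (t6Block₁ ν α) (t6Block₂ ν) t6Block₃)
      (egbOuterRight (t6Block₁ ν α) (t6Block₂ ν) t6Block₃)
  have h1 : (∫ v : ℝ, egbOuterIntegrand (t6Block₁ ν α) (t6Block₂ ν) t6Block₃ x y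
      (σ + v * Complex.I)) = Complex.Gamma ν * ∫ v : ℝ, Complex.Gamma (σ + v * Complex.I) *
        Complex.Gamma (-ν - (σ + v * Complex.I)) * (x : ℂ) ^ (-(σ + v * Complex.I : ℂ)) *
          expMellin y (fun u => (1 + u) ^ (-ν)) ((α : ℝ) - (σ + v * Complex.I)) := by
    rw [← integral_const_mul]
    refine integral_congr_ae (ae_of_all _ fun v => ?_)
    beta_reduce
    rw [t6_outerIntegrand hν hy (by simpa using hlt)]
    push_cast
    rfl
  set S : ℂ := ∑ k ∈ Finset.range n, (-1) ^ k / k.factorial *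
    Real.Gamma (k - ν) * (x ^ (ν - k) : ℝ) *
      expMellin y (fun u => (1 + u) ^ (-ν)) ((α + ν - k : ℝ)) with hS
  have hsum : ∑ k ∈ Finset.range n, (-1) ^ k / k.factorial * Real.Gamma (k + -ν) *
      (x ^ (ν - k) : ℝ) * expMellin y (fun u => (1 + u) ^ (-ν)) ((α + (ν - k) : ℝ)) = S := by
    refine Finset.sum_congr rfl fun k _ => ?_
    rw [← sub_eq_add_neg, add_sub_assoc]
  -- The line contributes `-S` and the clockwise circles contribute `+S`; only the Laplace integral
  -- survives.
  rw [h1, hline, hsum, ← hn, ← Finset.mul_sum, ← Finset.mul_sum, ← hS, expMellin_ofReal,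
    Complex.Gamma_ofReal]
  set J : ℝ := ∫ u in Set.Ioi (0 : ℝ), u ^ ((α : ℝ) - 1) *
    (Real.exp (-(y * u)) * ((1 + u) ^ (-ν) * (1 + x * u) ^ ν))
  have hI := Complex.I_ne_zero
  have hpi : (Real.pi : ℂ) ≠ 0 := by exact_mod_cast Real.pi_ne_zero
  push_cast
  field_simp
  ring

/-! ### Gamma laws -/

theorem integral_gammaMeasure {a r : ℝ} (ha : 0 < a) (hr : 0 < r) (f : ℝ → ℝ) :
    ∫ x, f x ∂gammaMeasure a r =
      ∫ x in Set.Ioi (0 : ℝ), r ^ a / Real.Gamma a * x ^ (a - 1) * Real.exp (-(r * x)) * f x := by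
  have hm : Measurable (gammaPDF a r) := (measurable_gammaPDFReal a r).ennreal_ofReal
  rw [gammaMeasure, integral_withDensity_eq_integral_toReal_smul hm
    (ae_of_all _ fun _ => ENNReal.ofReal_lt_top), ← integral_Ici_eq_integral_Ioi,
    ← integral_indicator measurableSet_Ici]
  refine integral_congr_ae (ae_of_all _ fun x => ?_)
  simp only [gammaPDF, smul_eq_mul]
  rw [ENNReal.toReal_ofReal (gammaPDFReal_nonneg ha hr x)]
  by_cases hx : 0 ≤ x
  · rw [Set.indicator_of_mem (Set.mem_Ici.2 hx), gammaPDFReal, if_pos hx]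
  · rw [Set.indicator_of_notMem (by simpa using hx), gammaPDFReal, if_neg hx, zero_mul]

/-- For `t ≥ r` the integrand dominates a multiple of `x ^ (a - 1)`, which is not integrable on the
half line, and the value `0` is the default of a divergent integral. -/
theorem mgf_gammaMeasure {a r : ℝ} (ha : 0 < a) (hr : 0 < r) (t : ℝ) :
    mgf id (gammaMeasure a r) t = if t < r then (r / (r - t)) ^ a else 0 := by
  have hΓ := Real.Gamma_pos_of_pos ha
  rw [mgf, integral_gammaMeasure ha hr]
  have h : ∀ x : ℝ, r ^ a / Real.Gamma a * x ^ (a - 1) * Real.exp (-(r * x)) *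
      Real.exp (t * id x) =
      r ^ a / Real.Gamma a * (x ^ (a - 1) * Real.exp (-((r - t) * x))) := by
    intro x
    rw [mul_assoc, ← Real.exp_add, mul_assoc]
    simp only [id]
    ring_nf
  simp_rw [h]
  rw [integral_const_mul]
  split_ifs with ht
  · rw [Real.integral_rpow_mul_exp_neg_mul_Ioi ha (sub_pos.2 ht), Real.div_rpow hr.le
      (sub_pos.2 ht).le, Real.div_rpow zero_le_one (sub_pos.2 ht).le, Real.one_rpow]
    field_simp
  · rw [integral_undef, mul_zero]
    intro hint
    refine not_integrableOn_Ioi_rpow (a - 1) (Integrable.mono' hint (Measurable.aestronglyMeasurable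
      (by fun_prop)) ?_)
    refine (ae_restrict_iff' measurableSet_Ioi).2 (ae_of_all _ fun x hx => ?_)
    rw [Set.mem_Ioi] at hx
    rw [Real.norm_of_nonneg (by positivity)]
    refine le_mul_of_one_le_right (by positivity) (Real.one_le_exp ?_)
    nlinarith

/-- As `r > 0`, the moment generating function is finite near `0`; it then determines the complex
one on a strip containing the imaginary axis, hence the characteristic function. -/
theorem eq_gammaMeasure_of_mgf {a r : ℝ} (ha : 0 < a) (hr : 0 < r) {ρ : Measure ℝ}
    [IsProbabilityMeasure ρ]
    (h : ∀ t, mgf id ρ t = if t < r then (r / (r - t)) ^ a else 0) : ρ = gammaMeasure a r := by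
  have := isProbabilityMeasure_gammaMeasure ha hr
  have hmgf : mgf id ρ = mgf id (gammaMeasure a r) :=
    funext fun t => (h t).trans (mgf_gammaMeasure ha hr t).symm
  refine Measure.ext_of_charFun (funext fun t => ?_)
  rw [← complexMGF_id_mul_I, ← complexMGF_id_mul_I]
  refine eqOn_complexMGF_of_mgf hmgf ?_
  have : Set.Iio r ⊆ integrableExpSet id ρ := by
    intro t ht
    rw [Set.mem_Iio] at ht
    -- Without integrability the value would be the default `0`, but it is prescribed to be
    -- positive.
    by_contra hcon
    have h0 : mgf id ρ t = 0 := mgf_undef hcon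
    rw [h t, if_pos ht] at h0
    have : 0 < (r / (r - t)) ^ a := Real.rpow_pos_of_pos (div_pos hr (sub_pos.2 ht)) _
    linarith
  simpa using interior_mono this (by simpa [isOpen_Iio.interior_eq] using hr)

/-- The density of `N(0, 1/2)` is `π ^ (-1/2) exp (-x ^ 2)`. The formula also covers `c ≥ 1`, where
both sides are `0` by default. -/
theorem integral_exp_mul_sq_gaussianReal (c : ℝ) :
    ∫ x, Real.exp (c * x ^ 2) ∂gaussianReal 0 (1 / 2) = (√Real.pi)⁻¹ * √(Real.pi / (1 - c)) := by
  rw [integral_gaussianReal_eq_integral_smul (by norm_num), ← integral_gaussian,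
    ← integral_const_mul]
  refine integral_congr_ae (ae_of_all _ fun x => ?_)
  simp only [gaussianPDFReal, smul_eq_mul]
  rw [mul_assoc, ← Real.exp_add]
  congr 2
  · congr 1
    push_cast
    ring
  · push_cast
    ring

theorem measurable_complex_mk : Measurable fun p : ℝ × ℝ => (⟨p.1, p.2⟩ : ℂ) :=
  Complex.measurableEquivRealProd.symm.measurable

instance : IsProbabilityMeasure stdComplexNormal :=
  Measure.isProbabilityMeasure_map measurable_complex_mk.aemeasurable

theorem mgf_mul_normSq_stdComplexNormal {Ω : ℝ} (t : ℝ) :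
    mgf (fun z : ℂ => ‖(√Ω : ℂ) * z‖ ^ 2) stdComplexNormal t =
      if t * √Ω ^ 2 < 1 then (1 - t * √Ω ^ 2)⁻¹ else 0 := by
  rw [mgf, stdComplexNormal, integral_map measurable_complex_mk.aemeasurable
    (Measurable.aestronglyMeasurable (by fun_prop))]
  have h : ∀ p : ℝ × ℝ, Real.exp (t * ‖(√Ω : ℂ) * (⟨p.1, p.2⟩ : ℂ)‖ ^ 2) =
      Real.exp (t * √Ω ^ 2 * p.1 ^ 2) * Real.exp (t * √Ω ^ 2 * p.2 ^ 2) := by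
    intro p
    rw [← Real.exp_add, norm_mul, mul_pow, Complex.norm_real, Complex.sq_norm ⟨p.1, p.2⟩,
      Complex.normSq_apply, Real.norm_of_nonneg (Real.sqrt_nonneg _)]
    ring_nf
  simp_rw [h]
  rw [integral_prod_mul (fun x => Real.exp (t * √Ω ^ 2 * x ^ 2))
    (fun x => Real.exp (t * √Ω ^ 2 * x ^ 2)), integral_exp_mul_sq_gaussianReal]
  have hpi := Real.pi_pos
  split_ifs with hc
  · have h1 : 0 < 1 - t * √Ω ^ 2 := sub_pos.2 hc
    rw [mul_mul_mul_comm, ← mul_inv, Real.mul_self_sqrt hpi.le,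
      Real.mul_self_sqrt (div_pos hpi h1).le]
    field_simp
  · have h1 : 1 - t * √Ω ^ 2 ≤ 0 := by linarith
    rw [Real.sqrt_eq_zero_of_nonpos (div_nonpos_of_nonneg_of_nonpos hpi.le h1)]
    simp

section Gains

variable {S : Type*} [MeasurableSpace S] {μ : Measure S}

/-- The channel gain after maximal-ratio combining has a Gamma law. -/
theorem hasLaw_mrcGain [IsProbabilityMeasure μ] {N : ℕ} (hN : 1 ≤ N) {Ω : ℝ} (hΩ : 0 < Ω) {h : Fin N → S → ℂ}
    (hlaw : ∀ i, HasLaw (h i) stdComplexNormal μ) (hindep : iIndepFun h μ) :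
    HasLaw (mrcGain Ω h) (gammaMeasure N (1 / Ω)) μ := by
  have hmeas : ∀ i, AEMeasurable (h i) μ := fun i => (hlaw i).aemeasurable
  have hXm : ∀ i, AEMeasurable (fun ω => ‖(√Ω : ℂ) * h i ω‖ ^ 2) μ := fun i =>
    (Measurable.comp_aemeasurable (g := fun z : ℂ => ‖(√Ω : ℂ) * z‖ ^ 2) (by fun_prop) (hmeas i))
  have hX : iIndepFun (fun i ω => ‖(√Ω : ℂ) * h i ω‖ ^ 2) μ :=
    hindep.comp (fun _ z => ‖(√Ω : ℂ) * z‖ ^ 2) fun _ => by fun_prop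
  have hg : mrcGain Ω h = ∑ i, fun ω => ‖(√Ω : ℂ) * h i ω‖ ^ 2 := by
    ext ω
    simp [mrcGain]
  have hgm : AEMeasurable (mrcGain Ω h) μ := by
    rw [hg]
    exact Finset.aemeasurable_sum _ fun i _ => hXm i
  refine ⟨hgm, ?_⟩
  have := Measure.isProbabilityMeasure_map hgm
  refine eq_gammaMeasure_of_mgf (by exact_mod_cast hN) (by positivity) fun t => ?_
  rw [mgf_id_map hgm, hg, hX.mgf_sum₀ hXm]
  have h1 : ∀ i, mgf (fun ω => ‖(√Ω : ℂ) * h i ω‖ ^ 2) μ t =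
      if t * Ω < 1 then (1 - t * Ω)⁻¹ else 0 := by
    intro i
    have h2 := mgf_mul_normSq_stdComplexNormal (Ω := Ω) t
    rw [Real.sq_sqrt hΩ.le] at h2
    rw [← h2, ← (hlaw i).map_eq, mgf_map (hmeas i) (Measurable.aestronglyMeasurable (by fun_prop))]
    rfl
  simp_rw [h1]
  rw [Finset.prod_const, Finset.card_univ, Fintype.card_fin]
  have hiff : t < 1 / Ω ↔ t * Ω < 1 := lt_div_iff₀ hΩ
  by_cases ht : t * Ω < 1
  · rw [if_pos ht, if_pos (hiff.2 ht), Real.rpow_natCast]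
    congr 1
    field_simp
  -- Here `N ≥ 1` matters: an empty product would be `1` instead of the default `0`.
  · rw [if_neg ht, if_neg (fun h => ht (hiff.1 h)), zero_pow (by omega)]

/-- The two gains are functions of disjoint blocks of one independent family. -/
theorem indepFun_mrcGain {Nn Nf : ℕ} (Ωn Ωf : ℝ) {hn : Fin Nn → S → ℂ} {hf : Fin Nf → S → ℂ}
    (hmn : ∀ i, AEMeasurable (hn i) μ) (hmf : ∀ i, AEMeasurable (hf i) μ)
    (hindep : iIndepFun (Sum.elim hn hf) μ) :
    IndepFun (mrcGain Ωn hn) (mrcGain Ωf hf) μ := by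
  classical
  obtain ⟨T, hT⟩ : ∃ T : Finset (Fin Nn ⊕ Fin Nf), T = Finset.univ.map ⟨Sum.inl, Sum.inl_injective⟩ :=
    ⟨_, rfl⟩
  obtain ⟨U, hU⟩ : ∃ U : Finset (Fin Nn ⊕ Fin Nf), U = Finset.univ.map ⟨Sum.inr, Sum.inr_injective⟩ :=
    ⟨_, rfl⟩
  have hTm : ∀ i, Sum.inl i ∈ T := by simp [hT]
  have hUm : ∀ i, Sum.inr i ∈ U := by simp [hU]
  have hTU : Disjoint T U := by
    rw [Finset.disjoint_left, hT, hU]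
    intro a ha hb
    simp only [Finset.mem_map, Finset.mem_univ, true_and, Function.Embedding.coeFn_mk] at ha hb
    obtain ⟨i, rfl⟩ := ha
    obtain ⟨j, hj⟩ := hb
    exact absurd hj (by simp)
  have h := hindep.indepFun_finset₀ T U hTU (by rintro (i | i); exacts [hmn i, hmf i])
  have hφ : Measurable fun z : T → ℂ => ∑ i : Fin Nn, ‖(√Ωn : ℂ) * z ⟨Sum.inl i, hTm i⟩‖ ^ 2 := by
    fun_prop
  have hψ : Measurable fun z : U → ℂ => ∑ i : Fin Nf, ‖(√Ωf : ℂ) * z ⟨Sum.inr i, hUm i⟩‖ ^ 2 := by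
    fun_prop
  exact h.comp hφ hψ

end Gains

/-! ### The minimum of two Gamma variables -/

/-- The right-hand side is minus an antiderivative of the density: in its derivative the sum
telescopes down to the top-degree term. -/
theorem gammaMeasure_real_Ioi {N : ℕ} (hN : 1 ≤ N) {r a : ℝ} (hr : 0 < r) (ha : 0 ≤ a) :
    (gammaMeasure N r).real (Set.Ioi a) =
      Real.exp (-(r * a)) * ∑ τ ∈ Finset.range N, (r * a) ^ τ / τ.factorial := by
  obtain ⟨n, rfl⟩ := Nat.exists_eq_add_of_le' hN
  have hN0 : (0 : ℝ) < (n + 1 : ℕ) := by positivity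
  rw [← integral_indicator_one measurableSet_Ioi, integral_gammaMeasure hN0 hr]
  have h1 : ∀ x, r ^ ((n + 1 : ℕ) : ℝ) / Real.Gamma (n + 1 : ℕ) * x ^ (((n + 1 : ℕ) : ℝ) - 1) *
      Real.exp (-(r * x)) * (Set.Ioi a).indicator 1 x =
      (Set.Ioi a).indicator
        (fun x => r ^ (n + 1) / n.factorial * x ^ n * Real.exp (-(r * x))) x := by
    intro x
    have e : Real.Gamma (n + 1 : ℕ) = n.factorial := by
      push_cast; exact Real.Gamma_nat_eq_factorial n
    have e2 : ((n + 1 : ℕ) : ℝ) - 1 = n := by push_cast; ring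
    rw [e, e2, Real.rpow_natCast, Real.rpow_natCast]
    by_cases hx : x ∈ Set.Ioi a
    · simp [Set.indicator_of_mem hx]
    · simp [Set.indicator_of_notMem hx]
  simp_rw [h1]
  rw [setIntegral_indicator measurableSet_Ioi, Set.Ioi_inter_Ioi, max_eq_right ha]
  set G : ℝ → ℝ := fun x =>
    -(Real.exp (-(r * x)) * ∑ τ ∈ Finset.range (n + 1), (r * x) ^ τ / τ.factorial) with hG
  have hE : ∀ x, HasDerivAt (fun x : ℝ => Real.exp (-(r * x))) (-r * Real.exp (-(r * x))) x := by
    intro x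
    have := (((hasDerivAt_id x).const_mul r).neg).exp
    simpa [mul_comm] using this
  have hS : ∀ (m : ℕ) (x : ℝ), HasDerivAt
      (fun x : ℝ => ∑ τ ∈ Finset.range (m + 1), (r * x) ^ τ / τ.factorial)
      (r * ∑ τ ∈ Finset.range m, (r * x) ^ τ / τ.factorial) x := by
    intro m x
    induction m with
    | zero => simpa using hasDerivAt_const x (1 : ℝ)
    | succ m ih =>
      simp_rw [Finset.sum_range_succ _ (m + 1)]
      have hp := (((hasDerivAt_id x).const_mul r).pow (m + 1)).div_const ((m + 1).factorial : ℝ)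
      refine (ih.add hp).congr_deriv ?_
      rw [Finset.sum_range_succ, Nat.factorial_succ]
      have : (m.factorial : ℝ) ≠ 0 := by positivity
      simp only [id, add_tsub_cancel_right]
      push_cast
      field_simp
  have hderiv : ∀ x ∈ Set.Ici a, HasDerivAt G
      (r ^ (n + 1) / n.factorial * x ^ n * Real.exp (-(r * x))) x := by
    intro x _
    refine ((hE x).mul (hS n x)).neg.congr_deriv ?_
    rw [Finset.sum_range_succ, mul_pow]
    ring
  have hlim : Filter.Tendsto G Filter.atTop (nhds 0) := by
    have hterm : ∀ τ : ℕ, Filter.Tendsto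
        (fun x : ℝ => Real.exp (-(r * x)) * ((r * x) ^ τ / τ.factorial))
        Filter.atTop (nhds 0) := by
      intro τ
      have h := ((Real.tendsto_pow_mul_exp_neg_atTop_nhds_zero τ).comp
        (Filter.tendsto_id.const_mul_atTop hr)).div_const (τ.factorial : ℝ)
      rw [zero_div] at h
      refine h.congr fun x => ?_
      simp only [Function.comp, id]
      ring
    have h := (tendsto_finsetSum (Finset.range (n + 1)) fun τ _ => hterm τ).neg
    simp only [Finset.sum_const_zero, neg_zero] at h
    refine h.congr fun x => ?_
    simp only [hG, Finset.mul_sum]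
  rw [integral_Ioi_of_hasDerivAt_of_nonneg' hderiv (fun x hx => ?_) hlim]
  · simp [hG]
  · have : 0 < x := ha.trans_lt hx
    positivity

/-- Expectation of a bounded function of the minimum of two independent variables. -/
theorem integral_min_prod {ρ₁ ρ₂ : Measure ℝ} [IsProbabilityMeasure ρ₁] [IsProbabilityMeasure ρ₂]
    {φ : ℝ → ℝ} (hφ : Measurable φ) {C : ℝ} (hC : ∀ x, ‖φ x‖ ≤ C) :
    ∫ p : ℝ × ℝ, φ (min p.1 p.2) ∂ρ₁.prod ρ₂ =
      (∫ x, φ x * ρ₂.real (Set.Ioi x) ∂ρ₁) + ∫ x, φ x * ρ₁.real (Set.Ici x) ∂ρ₂ := by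
  have hs1 : MeasurableSet {p : ℝ × ℝ | p.1 < p.2} := measurableSet_lt measurable_fst measurable_snd
  -- Ties go to the second variable, which is why its term carries the closed half line `Set.Ici`.
  have hs2 : MeasurableSet {p : ℝ × ℝ | p.2 ≤ p.1} := measurableSet_le measurable_snd measurable_fst
  have hi1 : Integrable (fun p : ℝ × ℝ => {p : ℝ × ℝ | p.1 < p.2}.indicator (fun p => φ p.1) p)
      (ρ₁.prod ρ₂) := by
    refine Integrable.indicator ?_ hs1
    exact Integrable.of_bound (hφ.comp measurable_fst).aestronglyMeasurable C
      (ae_of_all _ fun p => hC _)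
  have hi2 : Integrable (fun p : ℝ × ℝ => {p : ℝ × ℝ | p.2 ≤ p.1}.indicator (fun p => φ p.2) p)
      (ρ₁.prod ρ₂) := by
    refine Integrable.indicator ?_ hs2
    exact Integrable.of_bound (hφ.comp measurable_snd).aestronglyMeasurable C
      (ae_of_all _ fun p => hC _)
  have hsplit : ∀ p : ℝ × ℝ, φ (min p.1 p.2) =
      {p : ℝ × ℝ | p.1 < p.2}.indicator (fun p => φ p.1) p +
        {p : ℝ × ℝ | p.2 ≤ p.1}.indicator (fun p => φ p.2) p := by
    intro p
    rcases lt_or_ge p.1 p.2 with h | h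
    · simp [Set.indicator, h, not_le.2 h, min_eq_left h.le]
    · simp [Set.indicator, h, not_lt.2 h]
  simp_rw [hsplit]
  rw [integral_add hi1 hi2, integral_prod _ hi1, integral_prod_symm _ hi2]
  congr 1
  · refine integral_congr_ae (ae_of_all _ fun x => ?_)
    have : ∀ y, {p : ℝ × ℝ | p.1 < p.2}.indicator (fun p => φ p.1) (x, y) =
        (Set.Ioi x).indicator (fun _ => φ x) y := fun y => by simp [Set.indicator]
    simp_rw [this]
    rw [integral_indicator_const _ measurableSet_Ioi, smul_eq_mul, mul_comm]
  · refine integral_congr_ae (ae_of_all _ fun y => ?_)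
    have : ∀ x, {p : ℝ × ℝ | p.2 ≤ p.1}.indicator (fun p => φ p.2) (x, y) =
        (Set.Ici y).indicator (fun _ => φ y) x := fun x => by simp [Set.indicator]
    simp_rw [this]
    rw [integral_indicator_const _ measurableSet_Ici, smul_eq_mul, mul_comm]

theorem gammaMeasure_real_Ici (a r x : ℝ) :
    (gammaMeasure a r).real (Set.Ici x) = (gammaMeasure a r).real (Set.Ioi x) := by
  exact measureReal_congr
    ((withDensity_absolutelyContinuous _ _).ae_eq Ioi_ae_eq_Ici.symm)

/-- Density times tail: the exponential rates add, and the `τ`-th tail term raises the power of `x`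
by `τ`. -/
theorem integral_mul_gammaMeasure_real_Ioi {N M : ℕ} (hN : 1 ≤ N) (hM : 1 ≤ M) {r s : ℝ}
    (hr : 0 < r) (hs : 0 < s) {φ : ℝ → ℝ} (hφ : Measurable φ) {C : ℝ} (hC : ∀ x, ‖φ x‖ ≤ C) :
    ∫ x, φ x * (gammaMeasure M s).real (Set.Ioi x) ∂gammaMeasure N r =
      ∑ τ ∈ Finset.range M, r ^ N / Real.Gamma N * (s ^ τ / τ.factorial) *
        ∫ x in Set.Ioi (0 : ℝ), x ^ (((N + τ : ℕ) : ℝ) - 1) * Real.exp (-((r + s) * x)) * φ x := by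
  have hN0 : (0 : ℝ) < N := by exact_mod_cast hN
  rw [integral_gammaMeasure hN0 hr]
  simp_rw [← integral_const_mul]
  rw [← integral_finsetSum]
  · refine setIntegral_congr_fun measurableSet_Ioi fun x hx => ?_
    rw [Set.mem_Ioi] at hx
    rw [gammaMeasure_real_Ioi hM hs hx.le, Finset.mul_sum, Finset.mul_sum, Finset.mul_sum]
    refine Finset.sum_congr rfl fun τ _ => ?_
    have e1 : x ^ (((N + τ : ℕ) : ℝ) - 1) = x ^ ((N : ℝ) - 1) * x ^ τ := by
      rw [← Real.rpow_natCast x τ, ← Real.rpow_add hx]; push_cast; ring_nf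
    have e2 : Real.exp (-((r + s) * x)) = Real.exp (-(r * x)) * Real.exp (-(s * x)) := by
      rw [← Real.exp_add]; ring_nf
    rw [e1, e2, mul_pow, Real.rpow_natCast]
    ring
  · intro τ _
    refine Integrable.const_mul (Integrable.mul_bdd (c := C) ?_ hφ.aestronglyMeasurable
      (ae_of_all _ hC)) _
    have h := integrableOn_rpow_mul_exp_neg_mul_rpow (s := ((N + τ : ℕ) : ℝ) - 1) (p := 1)
      (b := r + s) (by
        push_cast
        have : (0 : ℝ) ≤ τ := τ.cast_nonneg
        linarith) zero_lt_one (by positivity)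
    refine h.congr_fun (fun x _ => ?_) measurableSet_Ioi
    beta_reduce
    rw [Real.rpow_one, neg_mul]

/-! ### The effective rate of the weak user -/

theorem sinrWeakSymbol_nonneg {aₛ a_w P g : ℝ} (haₛ : 0 < aₛ) (haw : 0 < a_w) (hP : 0 < P)
    (hg : 0 ≤ g) : 0 ≤ sinrWeakSymbol aₛ a_w P g := by
  unfold sinrWeakSymbol
  positivity

theorem sinrWeakSymbol_monotoneOn {aₛ a_w P : ℝ} (haₛ : 0 < aₛ) (haw : 0 < a_w) (hP : 0 < P) :
    MonotoneOn (sinrWeakSymbol aₛ a_w P) (Set.Ici 0) := by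
  intro g hg h hh hgh
  rw [Set.mem_Ici] at hg hh
  unfold sinrWeakSymbol
  rw [div_le_div_iff₀ (by positivity) (by positivity)]
  have : a_w * P * g ≤ a_w * P * h := by gcongr
  nlinarith

theorem mrcGain_nonneg {S : Type*} {N : ℕ} (Ω : ℝ) (h : Fin N → S → ℂ) (ω : S) :
    0 ≤ mrcGain Ω h ω :=
  Finset.sum_nonneg fun _ _ => by positivity

/-- The random variable whose expectation determines the effective rate, as a function of the
smaller gain. -/
noncomputable def weakPayoff (aₛ a_w P ν g : ℝ) : ℝ :=
  (1 + sinrWeakSymbol aₛ a_w P (max g 0)) ^ (-ν)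

theorem measurable_weakPayoff (aₛ a_w P ν : ℝ) : Measurable (weakPayoff aₛ a_w P ν) := by
  unfold weakPayoff sinrWeakSymbol
  fun_prop

/-- The truncation `max g 0` makes the bounds hold for every real `g`, as `integral_min_prod`
requires. -/
theorem weakPayoff_mem_Ioc {aₛ a_w P ν : ℝ} (haₛ : 0 < aₛ) (haw : 0 < a_w) (hP : 0 < P)
    (hν : 0 < ν) (g : ℝ) : weakPayoff aₛ a_w P ν g ∈ Set.Ioc 0 1 := by
  have h := sinrWeakSymbol_nonneg haₛ haw hP (le_max_right g 0)
  exact ⟨Real.rpow_pos_of_pos (by linarith) _,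
    Real.rpow_le_one_of_one_le_of_nonpos (by linarith) (by linarith)⟩

/-- Since `aₛ + a_w = 2 / K`, the numerator of `1 + γ` is `1 + (2P/K) g`, free of the individual
coefficients. -/
theorem weakPayoff_eq {aₛ a_w P ν g : ℝ} {K : ℕ} (hK : 0 < K) (haₛ : 0 < aₛ) (hP : 0 < P)
    (hsum : aₛ + a_w = 2 / K) (hg : 0 < g) :
    weakPayoff aₛ a_w P ν g =
      (1 + 2 * P / K * g) ^ (-ν) * (1 + K / 2 * aₛ * (2 * P / K * g)) ^ ν := by
  have hK' : (0 : ℝ) < K := by exact_mod_cast hK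
  have h1 : K / 2 * aₛ * (2 * P / K * g) = aₛ * P * g := by field_simp
  have h2 : 0 < 1 + aₛ * P * g := by positivity
  have h3 : 1 + sinrWeakSymbol aₛ a_w P g = (1 + 2 * P / K * g) / (1 + aₛ * P * g) := by
    have h4 : 2 * P / K * g = (aₛ + a_w) * P * g := by rw [hsum]; ring
    rw [h4, sinrWeakSymbol]
    field_simp
    ring
  rw [weakPayoff, max_eq_left hg.le, h3, h1, Real.div_rpow (by positivity) h2.le,
    Real.rpow_neg h2.le, div_inv_eq_mul]

theorem integral_Ioi_rescale {α b R y : ℝ} (hb : 0 < b) (hy : y * b = R) (W φ : ℝ → ℝ)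
    (hφ : ∀ g, 0 < g → φ g = W (b * g)) :
    ∫ g in Set.Ioi (0 : ℝ), g ^ (α - 1) * Real.exp (-(R * g)) * φ g =
      b ^ (-α) * ∫ u in Set.Ioi (0 : ℝ), u ^ (α - 1) * (Real.exp (-(y * u)) * W u) := by
  have h := integral_comp_mul_left_Ioi
    (fun u : ℝ => u ^ (α - 1) * (Real.exp (-(y * u)) * W u)) 0 hb
  rw [mul_zero, smul_eq_mul] at h
  have hbα : b ^ (-α) = b ^ (-(α - 1)) * b⁻¹ := by
    rw [← Real.rpow_neg_one b, ← Real.rpow_add hb]; ring_nf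
  rw [hbα, mul_assoc, ← h, ← integral_const_mul]
  refine setIntegral_congr_fun measurableSet_Ioi fun g hg => ?_
  rw [Set.mem_Ioi] at hg
  have e : b ^ (-(α - 1)) * b ^ (α - 1) = 1 := by
    rw [← Real.rpow_add hb, neg_add_cancel, Real.rpow_zero]
  rw [hφ g hg, Real.mul_rpow hb.le hg.le, ← hy]
  have e2 : y * b * g = y * (b * g) := by ring
  rw [e2]
  linear_combination (-(g ^ (α - 1) * Real.exp (-(y * (b * g))) * W (b * g))) * e

/-- The factor `Γ(ν) Γ(-ν)` of the Meijer function cancels the one in the coefficient, and `(2P/K) ^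
(-(α₁ + τ))` is the Jacobian and power factor of the substitution `u = (2P/K) g`. -/
theorem T6_eq {ν P aₛ a_w Ωh β₁ β₂ : ℝ} {K α₁ α₂ : ℕ} (hν : 0 < ν) (hνk : ∀ k : ℕ, ν ≠ k)
    (hK : 0 < K) (haₛ : 0 < aₛ) (hP : 0 < P) (hsum : aₛ + a_w = 2 / K) (hα₁ : 1 ≤ α₁)
    (hβ₁ : 0 < β₁) (hβ₂ : 0 < β₂) (hΩ : 0 < Ωh) (hβ : 1 / Ωh = 1 / β₁ + 1 / β₂) :
    T6 ν P aₛ Ωh K α₁ α₂ β₁ β₂ =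
      ((∑ τ ∈ Finset.range α₂, (1 / β₁) ^ α₁ / Real.Gamma α₁ * ((1 / β₂) ^ τ / τ.factorial) *
        ∫ x in Set.Ioi (0 : ℝ), x ^ (((α₁ + τ : ℕ) : ℝ) - 1) *
          Real.exp (-((1 / β₁ + 1 / β₂) * x)) * weakPayoff aₛ a_w P ν x : ℝ) : ℂ) := by
  have hK' : (0 : ℝ) < K := by exact_mod_cast hK
  have hΓ : Real.Gamma ν ≠ 0 := (Real.Gamma_pos_of_pos hν).ne'
  have hΓ' : Real.Gamma (-ν) ≠ 0 := Real.Gamma_ne_zero fun m h => hνk m (neg_injective h)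
  rw [T6, Complex.ofReal_sum]
  refine Finset.sum_congr rfl fun τ _ => ?_
  rw [egbMeijerG_t6 hν hνk (by omega : 1 ≤ α₁ + τ) (by positivity) (by positivity),
    ← Complex.ofReal_mul]
  congr 1
  rw [integral_Ioi_rescale (b := 2 * P / K) (y := K / (2 * Ωh * P)) (by positivity)
    (by rw [← hβ]; field_simp)
    (fun u => (1 + u) ^ (-ν) * (1 + K / 2 * aₛ * u) ^ ν) _
    fun g hg => weakPayoff_eq hK haₛ hP hsum hg]
  rw [one_div_pow, one_div_pow]
  set J : ℝ := ∫ u in Set.Ioi (0 : ℝ), u ^ (((α₁ + τ : ℕ) : ℝ) - 1) *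
    (Real.exp (-(K / (2 * Ωh * P) * u)) * ((1 + u) ^ (-ν) * (1 + K / 2 * aₛ * u) ^ ν))
  field_simp

theorem integral_weakPayoff_min {S : Type*} [MeasurableSpace S] {μ : Measure S}
    [IsProbabilityMeasure μ] {ν P aₛ a_w Ωh Ωn Ωf : ℝ} {K Nn Nf : ℕ} (hν : 0 < ν)
    (hνk : ∀ k : ℕ, ν ≠ k) (hK : 0 < K) (haₛ : 0 < aₛ) (haw : 0 < a_w) (hP : 0 < P)
    (hsum : aₛ + a_w = 2 / K) (hNn : 1 ≤ Nn) (hNf : 1 ≤ Nf) (hΩn : 0 < Ωn) (hΩf : 0 < Ωf)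
    (hΩh : Ωh = Ωn * Ωf / (Ωn + Ωf)) {gn gf : S → ℝ}
    (hgn : HasLaw gn (gammaMeasure Nn (1 / Ωn)) μ) (hgf : HasLaw gf (gammaMeasure Nf (1 / Ωf)) μ)
    (hind : IndepFun gn gf μ) :
    T6 ν P aₛ Ωh K Nn Nf Ωn Ωf + T6 ν P aₛ Ωh K Nf Nn Ωf Ωn =
      ((∫ ω, weakPayoff aₛ a_w P ν (min (gn ω) (gf ω)) ∂μ : ℝ) : ℂ) := by
  have hn0 : (0 : ℝ) < Nn := by exact_mod_cast hNn
  have hf0 : (0 : ℝ) < Nf := by exact_mod_cast hNf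
  have hrn : 0 < 1 / Ωn := by positivity
  have hrf : 0 < 1 / Ωf := by positivity
  have := isProbabilityMeasure_gammaMeasure hn0 hrn
  have := isProbabilityMeasure_gammaMeasure hf0 hrf
  have hφ := measurable_weakPayoff aₛ a_w P ν
  have hC : ∀ x, ‖weakPayoff aₛ a_w P ν x‖ ≤ 1 := fun x => by
    obtain ⟨h1, h2⟩ := weakPayoff_mem_Ioc haₛ haw hP hν x
    rwa [Real.norm_of_nonneg h1.le]
  have hΩ : 0 < Ωh := by rw [hΩh]; positivity
  have hβ : 1 / Ωh = 1 / Ωn + 1 / Ωf := by rw [hΩh]; field_simp; ring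
  have hmap : μ.map (fun ω => (gn ω, gf ω)) =
      (gammaMeasure Nn (1 / Ωn)).prod (gammaMeasure Nf (1 / Ωf)) := by
    rw [(indepFun_iff_map_prod_eq_prod_map_map hgn.aemeasurable hgf.aemeasurable).1 hind,
      hgn.map_eq, hgf.map_eq]
  have hE : ∫ ω, weakPayoff aₛ a_w P ν (min (gn ω) (gf ω)) ∂μ =
      ∫ p : ℝ × ℝ, weakPayoff aₛ a_w P ν (min p.1 p.2)
        ∂(gammaMeasure Nn (1 / Ωn)).prod (gammaMeasure Nf (1 / Ωf)) := by
    rw [← hmap, integral_map (hgn.aemeasurable.prodMk hgf.aemeasurable)]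
    exact (hφ.comp (measurable_fst.min measurable_snd)).aestronglyMeasurable
  rw [hE, integral_min_prod hφ hC]
  simp_rw [gammaMeasure_real_Ici]
  rw [integral_mul_gammaMeasure_real_Ioi hNn hNf hrn hrf hφ hC,
    integral_mul_gammaMeasure_real_Ioi hNf hNn hrf hrn hφ hC, Complex.ofReal_add,
    T6_eq hν hνk hK haₛ hP hsum hNn hΩn hΩf hΩ hβ,
    T6_eq hν hνk hK haₛ hP hsum hNf hΩf hΩn hΩ (hβ.trans (add_comm _ _))]

theorem mainTheorem5 {S : Type*} [MeasurableSpace S] (μ : Measure S) [IsProbabilityMeasure μ]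
    -- system parameters
    (K : ℕ) (hK : 0 < K) (hKeven : Even K)
    (Nn Nf : ℕ) (hNn : 1 ≤ Nn) (hNf : 1 ≤ Nf)
    (Ωn Ωf Ωp : ℝ) (hΩn : 0 < Ωn) (hΩf : 0 < Ωf) (hΩp : 0 < Ωp)
    (aₛ a_w : ℝ) (haₛ : 0 < aₛ) (haw : aₛ < a_w) (hsum : aₛ + a_w = 2 / K)
    (I δ N₀ B T θ : ℝ) (hI : 0 < I) (hδ₀ : 0 < δ) (hδ₁ : δ < 1) (hN₀ : 0 < N₀)
    (hB : 0 < B) (hT : 0 < T) (hθ : 0 < θ)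
    -- bandwidth of a user pair, transmit power, normalized transmit power, exponent
    (Bpair Pt P ν : ℝ) (hBpair : Bpair = 2 * B / K)
    (hPt : Pt = -I / (Ωp * Real.log δ)) (hP : P = Pt / (N₀ * Bpair))
    (hν : ν = θ * T * Bpair / Real.log 2)
    (hνint : ∀ k : ℕ, ν ≠ k)
    -- independent Rayleigh fading
    (hhatn : Fin Nn → S → ℂ) (hhatf : Fin Nf → S → ℂ)
    (hlawn : ∀ i, HasLaw (hhatn i) stdComplexNormal μ)
    (hlawf : ∀ i, HasLaw (hhatf i) stdComplexNormal μ)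
    (hindep : iIndepFun (Sum.elim hhatn hhatf) μ)
    (Ωh : ℝ) (hΩh : Ωh = Ωn * Ωf / (Ωn + Ωf)) :
    -- the bivariate Meijer G-functions are well defined
    (∀ α ∈ Finset.Ico Nn (Nn + Nf) ∪ Finset.Ico Nf (Nf + Nn),
      EGBMeijerGConverges (t6Block₁ ν α) (t6Block₂ ν) t6Block₃
        (K / 2 * aₛ) (K / (2 * Ωh * P))) ∧
    -- the argument of the logarithm is a positive real number
    (T6 ν P aₛ Ωh K Nn Nf Ωn Ωf + T6 ν P aₛ Ωh K Nf Nn Ωf Ωn).im = 0 ∧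
    0 < (T6 ν P aₛ Ωh K Nn Nf Ωn Ωf + T6 ν P aₛ Ωh K Nf Nn Ωf Ωn).re ∧
    -- instantaneous secondary-link CSI
    effectiveRate μ ν
        (sinrWeakInstantaneous aₛ a_w P (mrcGain Ωn hhatn) (mrcGain Ωf hhatf)) =
      -(1 / ν) * Real.logb 2
        (T6 ν P aₛ Ωh K Nn Nf Ωn Ωf + T6 ν P aₛ Ωh K Nf Nn Ωf Ωn).re ∧
    -- statistical secondary-link CSI
    effectiveRate μ ν
        (sinrWeakStatistical aₛ a_w P (mrcGain Ωn hhatn) (mrcGain Ωf hhatf)) =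
      -(1 / ν) * Real.logb 2
        (T6 ν P aₛ Ωh K Nn Nf Ωn Ωf + T6 ν P aₛ Ωh K Nf Nn Ωf Ωn).re := by
  have hK' : (0 : ℝ) < K := by exact_mod_cast hK
  have haw0 : 0 < a_w := haₛ.trans haw
  have hBp : 0 < Bpair := by rw [hBpair]; positivity
  have hP0 : 0 < P := by
    have hlog := Real.log_neg hδ₀ hδ₁
    rw [hP, hPt]
    exact div_pos (div_pos_of_neg_of_neg (by linarith) (mul_neg_of_pos_of_neg hΩp hlog))
      (mul_pos hN₀ hBp)
  have hν0 : 0 < ν := by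
    have := Real.log_pos one_lt_two
    rw [hν]
    positivity
  have hΩ : 0 < Ωh := by rw [hΩh]; positivity
  have hlawgn := hasLaw_mrcGain hNn hΩn hlawn (hindep.precomp (g := Sum.inl) Sum.inl_injective)
  have hlawgf := hasLaw_mrcGain hNf hΩf hlawf (hindep.precomp (g := Sum.inr) Sum.inr_injective)
  have hind := indepFun_mrcGain Ωn Ωf (fun i => (hlawn i).aemeasurable)
    (fun i => (hlawf i).aemeasurable) hindep
  set gn := mrcGain Ωn hhatn with hgn
  set gf := mrcGain Ωf hhatf with hgf
  have hT := integral_weakPayoff_min hν0 hνint hK haₛ haw0 hP0 hsum hNn hNf hΩn hΩf hΩh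
    hlawgn hlawgf hind
  have hpay : ∀ ω, weakPayoff aₛ a_w P ν (min (gn ω) (gf ω)) =
      (1 + sinrWeakInstantaneous aₛ a_w P gn gf ω) ^ (-ν) := by
    intro ω
    rw [weakPayoff, max_eq_left (le_min (mrcGain_nonneg _ _ _) (mrcGain_nonneg _ _ _))]
    rfl
  -- A function monotone on the nonnegative half line commutes with the minimum of nonnegative
  -- gains.
  have hstat : sinrWeakStatistical aₛ a_w P gn gf = sinrWeakInstantaneous aₛ a_w P gn gf := by
    ext ω
    exact ((sinrWeakSymbol_monotoneOn haₛ haw0 hP0).map_min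
      (Set.mem_Ici.2 (mrcGain_nonneg _ _ _)) (Set.mem_Ici.2 (mrcGain_nonneg _ _ _))).symm
  have hrate : effectiveRate μ ν (sinrWeakInstantaneous aₛ a_w P gn gf) =
      -(1 / ν) * Real.logb 2
        (T6 ν P aₛ Ωh K Nn Nf Ωn Ωf + T6 ν P aₛ Ωh K Nf Nn Ωf Ωn).re := by
    rw [hT, Complex.ofReal_re, effectiveRate]
    simp_rw [hpay]
  refine ⟨?_, ?_, ?_, hrate, hstat ▸ hrate⟩
  · intro α hα
    refine t6_converges hν0 hνint ?_ (by positivity) (by positivity)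
    rcases Finset.mem_union.1 hα with h | h
    · exact hNn.trans (Finset.mem_Ico.1 h).1
    · exact hNf.trans (Finset.mem_Ico.1 h).1
  · rw [hT, Complex.ofReal_im]
  · rw [hT, Complex.ofReal_re]
    have hm : AEMeasurable (fun ω => min (gn ω) (gf ω)) μ :=
      hlawgn.aemeasurable.min hlawgf.aemeasurable
    have hbound := fun ω => weakPayoff_mem_Ioc haₛ haw0 hP0 hν0 (min (gn ω) (gf ω))
    have hint : Integrable (fun ω => weakPayoff aₛ a_w P ν (min (gn ω) (gf ω))) μ := by
      refine Integrable.of_bound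
        ((measurable_weakPayoff aₛ a_w P ν).comp_aemeasurable hm).aestronglyMeasurable 1
        (ae_of_all _ fun ω => ?_)
      rw [Real.norm_of_nonneg (hbound ω).1.le]
      exact (hbound ω).2
    rw [integral_pos_iff_support_of_nonneg (fun ω => (hbound ω).1.le) hint]
    have hsupp : Function.support (fun ω => weakPayoff aₛ a_w P ν (min (gn ω) (gf ω))) =
        Set.univ := Set.eq_univ_of_forall fun ω => (hbound ω).1.ne'
    rw [hsupp, measure_univ]
    exact zero_lt_one
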